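/- Let $q\in\mathbb{C}^*$, fix a square root $q^{1/2}\in\mathbb{C}^*$ of $q$ and write $q^{n/2}=(q^{1/2})^n$. Let $n\ge 1$, let $C_1,\dots,C_4$ be conjugacy classes in $GL(n,\mathbb{C})$ with $\det(C_1)\det(C_2)\det(C_3)\det(C_4)=q^{n/2}$, where $\det(C_i)$ is the common determinant of the elements of $C_i$. Let $\Delta$ be the set of 4-tuples $(a,b,c,d)\in C_1\times C_2\times C_3\times C_4$ which are irreducible (no subspace of $\mathbb{C}^n$ other than $0$ and $\mathbb{C}^n$ is invariant under all of $a,b,c,d$) and satisfy $abcd=q^{1/2}\cdot\mathrm{Id}$. Dimensions are those of algebraic varieties, i.e. Krull dimensions with respect to the Zariski topology of the space of matrices (respectively of 4-tuples of matrices). The dimensions $\dim C_i$ are finite. Put $$D=\dim C_1+\dim C_2+\dim C_3+\dim C_4-n^2+1.$$ If $D\ge 0$ and $\Delta$ is nonempty, then $\dim\Delta=D$. If $D<0$, then $\Delta=\emptyset$. -/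

import Mathlib

noncomputable section

/-- The Zariski topology on the affine space `ℂ^σ`, i.e. the topology induced by the map
sending a point to the corresponding maximal ideal of the polynomial ring.
Its closed sets are exactly the common zero sets of polynomials, see
`zariskiTopology_isClosed_iff`. -/
@[reducible] def zariskiTopology (σ : Type) : TopologicalSpace (σ → ℂ) :=
  TopologicalSpace.induced
    (MvPolynomial.pointToPoint : (σ → ℂ) → PrimeSpectrum (MvPolynomial σ ℂ)) inferInstance

theorem zariskiTopology_isClosed_iff {σ : Type} (Z : Set (σ → ℂ)) :
    @IsClosed _ (zariskiTopology σ) Z ↔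
      ∃ P : Set (MvPolynomial σ ℂ), Z = {x | ∀ p ∈ P, MvPolynomial.eval x p = 0} := by
  have key : ∀ P : Set (MvPolynomial σ ℂ),
      (MvPolynomial.pointToPoint : (σ → ℂ) → PrimeSpectrum (MvPolynomial σ ℂ)) ⁻¹'
        PrimeSpectrum.zeroLocus P = {x | ∀ p ∈ P, MvPolynomial.eval x p = 0} := by
    intro P
    ext x
    simp [MvPolynomial.pointToPoint, PrimeSpectrum.mem_zeroLocus, Set.subset_def]
  rw [isClosed_induced_iff]
  constructor
  · rintro ⟨t, ht, rfl⟩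
    obtain ⟨P, rfl⟩ := (PrimeSpectrum.isClosed_iff_zeroLocus t).1 ht
    exact ⟨P, key P⟩
  · rintro ⟨P, rfl⟩
    exact ⟨_, PrimeSpectrum.isClosed_zeroLocus P, key P⟩

/-- The dimension of a subset `X` of the affine space `ℂ^σ`: the Krull dimension of `X` as a
topological space, with the subspace topology of the Zariski topology. (It is `⊥` exactly for
the empty set.) -/
def zariskiDim {σ : Type} (X : Set (σ → ℂ)) : WithBot ℕ∞ :=
  @topologicalKrullDim X (TopologicalSpace.induced Subtype.val (zariskiTopology σ))

/-- The determinant of (any element of) a conjugacy class of `GL(n, ℂ)`. -/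
def classDet {n : ℕ} (C : ConjClasses (GL (Fin n) ℂ)) : ℂ :=
  Quotient.liftOn C (fun g => (g : Matrix (Fin n) (Fin n) ℂ).det) (by
    intro g h hgh
    obtain ⟨c, rfl⟩ := isConj_iff.1 hgh
    have e : ((Matrix.GeneralLinearGroup.det (c * g * c⁻¹) : ℂˣ) : ℂ)
        = (Matrix.GeneralLinearGroup.det g : ℂˣ) := by
      congr 1
      rw [map_mul, map_mul, map_inv, mul_right_comm, mul_inv_cancel, one_mul]
    exact e.symm)

/-- The point of the affine space `ℂ^(n × n)` given by the entries of an invertible matrix. -/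
def matrixPoint {n : ℕ} (g : GL (Fin n) ℂ) : Fin n × Fin n → ℂ :=
  fun p => (g : Matrix (Fin n) (Fin n) ℂ) p.1 p.2

/-- The point of the affine space `ℂ^(4 × n × n)` given by the entries of a 4-tuple of
invertible matrices. -/
def tuplePoint {n : ℕ} (A : Fin 4 → GL (Fin n) ℂ) : Fin 4 × Fin n × Fin n → ℂ :=
  fun p => (A p.1 : Matrix (Fin n) (Fin n) ℂ) p.2.1 p.2.2

/-- A 4-tuple of matrices is irreducible if `ℂ^n` is nonzero and has no common invariant
subspaces other than `0` and `ℂ^n`. -/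
def IsIrreducibleTuple {n : ℕ} (A : Fin 4 → GL (Fin n) ℂ) : Prop :=
  0 < n ∧ ∀ W : Submodule ℂ (Fin n → ℂ),
    (∀ i, ∀ w ∈ W, (A i : Matrix (Fin n) (Fin n) ℂ).mulVec w ∈ W) → W = ⊥ ∨ W = ⊤

/-- The set `Δ` of irreducible 4-tuples `(a, b, c, d)` in `C₁ × C₂ × C₃ × C₄` such that `abcd`
is the scalar matrix `r`. -/
def DeltaSet {n : ℕ} (C : Fin 4 → ConjClasses (GL (Fin n) ℂ)) (r : ℂ) :
    Set (Fin 4 → GL (Fin n) ℂ) :=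
  {A | (∀ i, A i ∈ (C i).carrier) ∧ IsIrreducibleTuple A ∧
    ((A 0 * A 1 * A 2 * A 3 : GL (Fin n) ℂ) : Matrix (Fin n) (Fin n) ℂ) = Matrix.scalar (Fin n) r}

/-- The dimension of a conjugacy class of `GL(n, ℂ)`. -/
def classDim {n : ℕ} (C : ConjClasses (GL (Fin n) ℂ)) : WithBot ℕ∞ :=
  zariskiDim (matrixPoint '' C.carrier)

/-- The dimension of a set of 4-tuples of invertible matrices. -/
def tupleDim {n : ℕ} (S : Set (Fin 4 → GL (Fin n) ℂ)) : WithBot ℕ∞ :=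
  zariskiDim (tuplePoint '' S)

end

/-! Everything is local. A `T1` space whose local dimension, the coheight of the closed point among
irreducible closed sets, is a constant `d` has Krull dimension `d`; and local dimension is unchanged
by maps that are mutually inverse and Zariski continuous near the point.

Near `a`, a conjugacy class is parametrised by `v ↦ (1 + ι v) a (1 + ι v)⁻¹`, where `ι` embeds a
complement of the centralizer of `a`. The inverse is rational because `(1 + ι v) a = b (1 + ι v)` is
affine linear in `v`. Hence a class has dimension equal to the rank of `x ↦ x a - a x`
(`localDim_eq_localDim_slice`, `zariskiDim_conjugates`). The same chart serves 4-tuples, in the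
product algebra of four matrix algebras.

In this chart `Δ` is cut out near an irreducible tuple by `n² - 1` equations `ψ (abcd) = 0`, with
`ψ` running over a basis of the functionals killing the identity. They force `abcd` to be a scalar
`c`, the determinant gives `c ^ n = r ^ n`, and near `c = r` this gives `c = r`. Irreducibility is
an open condition by Burnside's theorem. The differentials of the equations are independent: a
functional `X ↦ tr (K X)` annihilating the derivative of the product has `K` commuting with all four
matrices, so `K` is scalar by Schur, and it is zero because the functional kills the identity
(`eq_zero_of_productDerivative`).

The Jacobian criterion (`localDim_zeroLocus_of_linearIndependent`), proved through heights of
ideals, gives local dimension `∑ dim Cᵢ - (n² - 1) = D` at every point of `Δ`. Independence also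
gives `n² - 1 ≤ ∑ dim Cᵢ` as soon as `Δ` has a point, which settles `D < 0`. -/

noncomputable section

open TopologicalSpace Topology

/-! ### The Zariski topology on affine space -/

/-- The affine space `ℂ^σ` as a topological space with the Zariski topology. -/
def ZariskiSpace (σ : Type) : Type := σ → ℂ

instance (σ : Type) : TopologicalSpace (ZariskiSpace σ) := zariskiTopology σ

namespace ZariskiSpace

variable {σ : Type}

theorem isClosed_iff (Z : Set (ZariskiSpace σ)) :
    IsClosed Z ↔ ∃ P : Set (MvPolynomial σ ℂ), Z = {x | ∀ p ∈ P, MvPolynomial.eval x p = 0} :=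
  zariskiTopology_isClosed_iff Z

theorem isClosed_setOf_eval_eq_zero (p : MvPolynomial σ ℂ) :
    IsClosed {x : ZariskiSpace σ | MvPolynomial.eval x p = 0} :=
  (isClosed_iff _).2 ⟨{p}, Set.ext fun _ =>
    ⟨fun h _ hq => (Set.mem_singleton_iff.1 hq) ▸ h, fun h => h p rfl⟩⟩

theorem isOpen_setOf_eval_ne_zero (p : MvPolynomial σ ℂ) :
    IsOpen {x : ZariskiSpace σ | MvPolynomial.eval x p ≠ 0} :=
  (isClosed_setOf_eval_eq_zero p).isOpen_compl

instance : T1Space (ZariskiSpace σ) where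
  t1 x := by
    refine (isClosed_iff _).2 ⟨Set.range fun i => MvPolynomial.X i - MvPolynomial.C (x i), ?_⟩
    ext y
    simp only [Set.mem_singleton_iff, Set.forall_mem_range, map_sub, MvPolynomial.eval_X,
      MvPolynomial.eval_C, sub_eq_zero]
    exact ⟨fun h i => congrFun h i, fun h => funext h⟩

end ZariskiSpace

/-! ### Local dimension -/

/-- The local dimension of a `T1` space at a point. -/
def localDim (X : Type*) [TopologicalSpace X] [T1Space X] (x : X) : ℕ∞ :=
  Order.coheight ({x} : IrreducibleCloseds X)

/-- Every irreducible closed set contains a point, and coheight is antitone, so the supremum of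
coheights is attained on points. -/
theorem topologicalKrullDim_eq_of_localDim {X : Type*} [TopologicalSpace X] [T1Space X]
    [Nonempty X] {d : ℕ∞} (h : ∀ x : X, localDim X x = d) : topologicalKrullDim X = d := by
  rw [topologicalKrullDim, Order.krullDim_eq_iSup_coheight]
  apply le_antisymm
  · refine iSup_le fun Z => ?_
    obtain ⟨x, hx⟩ := Z.isIrreducible.nonempty
    rw [← h x]
    exact WithBot.coe_le_coe.2 (Order.coheight_anti (by
      change (({x} : IrreducibleCloseds X) : Set X) ⊆ Z
      simpa using hx))
  · obtain ⟨x⟩ := ‹Nonempty X›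
    rw [← h x]
    exact le_iSup (fun Z : IrreducibleCloseds X => ((Order.coheight Z : ℕ∞) : WithBot ℕ∞)) {x}

theorem Topology.IsOpenEmbedding.localDim_eq {X Y : Type*} [TopologicalSpace X] [T1Space X]
    [TopologicalSpace Y] [T1Space Y] {f : X → Y} (hf : IsOpenEmbedding f) (x : X) :
    localDim X x = localDim Y (f x) := by
  rw [localDim, ← hf.coheight_map, localDim]
  congr 1
  ext y
  simp

theorem localDim_inter_isOpen {X : Type*} [TopologicalSpace X] [T1Space X] {A V : Set X}
    (hV : IsOpen V) {x : X} (hA : x ∈ A) (hx : x ∈ V) :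
    localDim ↥(A ∩ V) ⟨x, hA, hx⟩ = localDim A ⟨x, hA⟩ := by
  refine IsOpenEmbedding.localDim_eq (f := Set.inclusion (s := A ∩ V) (t := A)
    Set.inter_subset_left) ⟨.inclusion _, ?_⟩ ⟨x, hA, hx⟩
  rw [Set.range_inclusion]
  convert hV.preimage continuous_subtype_val using 1
  ext y
  simp

theorem localDim_congr_of_inter_eq {X : Type*} [TopologicalSpace X] [T1Space X] {A B V : Set X}
    (hV : IsOpen V) {x : X} (hA : x ∈ A) (hx : x ∈ V) (hB : x ∈ B) (h : A ∩ V = B ∩ V) :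
    localDim A ⟨x, hA⟩ = localDim B ⟨x, hB⟩ := by
  rw [← localDim_inter_isOpen hV hA hx, ← localDim_inter_isOpen hV hB hx]
  have key : ∀ (C D : Set X) (hC : x ∈ C) (hD : x ∈ D), C = D →
      localDim C ⟨x, hC⟩ = localDim D ⟨x, hD⟩ := by
    rintro C D hC hD rfl
    rfl
  exact key _ _ _ _ h

/-- Continuity and inversion are asked only on the relatively open pieces, so `f` and `g` may be
rational maps with junk values elsewhere. -/
theorem localDim_eq_of_local_homeomorph {X Y : Type*} [TopologicalSpace X] [T1Space X]
    [TopologicalSpace Y] [T1Space Y] {A V : Set X} {B U : Set Y} (hV : IsOpen V) (hU : IsOpen U)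
    {f : X → Y} {g : Y → X} (hf : ContinuousOn f (A ∩ V)) (hg : ContinuousOn g (B ∩ U))
    (hfU : Set.MapsTo f (A ∩ V) (B ∩ U)) (hgV : Set.MapsTo g (B ∩ U) (A ∩ V))
    (hgf : Set.LeftInvOn g f (A ∩ V)) (hfg : Set.LeftInvOn f g (B ∩ U))
    {x : X} (hA : x ∈ A) (hx : x ∈ V) {y : Y} (hB : y ∈ B) (hxy : f x = y) :
    localDim A ⟨x, hA⟩ = localDim B ⟨y, hB⟩ := by
  subst hxy
  let φ : ↥(A ∩ V) ≃ₜ ↥(B ∩ U) :=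
    { toFun := hfU.restrict
      invFun := hgV.restrict
      left_inv := fun a => Subtype.ext (hgf a.2)
      right_inv := fun b => Subtype.ext (hfg b.2)
      continuous_toFun := hf.mapsToRestrict hfU
      continuous_invFun := hg.mapsToRestrict hgV }
  rw [← localDim_inter_isOpen hV hA hx, φ.isOpenEmbedding.localDim_eq,
    ← localDim_inter_isOpen hU hB (hfU ⟨hA, hx⟩).2]
  rfl

/-! ### Point ideals and local dimension of zero loci -/

namespace ZariskiSpace

variable {σ : Type}

/-- The maximal ideal of polynomials vanishing at a point. -/
def pointIdeal (x : σ → ℂ) : Ideal (MvPolynomial σ ℂ) := MvPolynomial.vanishingIdeal ℂ {x}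

instance pointIdeal_isMaximal (x : σ → ℂ) : (pointIdeal x).IsMaximal :=
  inferInstanceAs (MvPolynomial.vanishingIdeal ℂ {x}).IsMaximal

theorem mem_pointIdeal {x : σ → ℂ} {p : MvPolynomial σ ℂ} :
    p ∈ pointIdeal x ↔ MvPolynomial.eval x p = 0 := by
  rw [pointIdeal, MvPolynomial.mem_vanishingIdeal_singleton_iff, MvPolynomial.aeval_eq_eval]

theorem X_sub_C_mem_pointIdeal (x : σ → ℂ) (i : σ) :
    MvPolynomial.X i - MvPolynomial.C (x i) ∈ pointIdeal x :=
  mem_pointIdeal.2 (by simp)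

/-- Some maximal ideal attains the Krull dimension; by the Nullstellensatz it is the ideal of a
point `y`, and a translation carries `y` to `x`. -/
theorem pointIdeal_height_eq [Finite σ] (x : σ → ℂ) :
    (pointIdeal x).height = Nat.card σ := by
  have hN : ringKrullDim (MvPolynomial σ ℂ) = (Nat.card σ : ℕ∞) := by
    rw [MvPolynomial.ringKrullDim_of_isNoetherianRing, ringKrullDim_eq_zero_of_field, zero_add]
    rfl
  have : FiniteRingKrullDim (MvPolynomial σ ℂ) :=
    finiteRingKrullDim_iff_ne_bot_and_top.2 (by rw [hN]; exact ⟨by simp, by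
      intro h; exact ENat.natCast_ne_top _ (WithBot.coe_injective h)⟩)
  obtain ⟨m, hm, hmN⟩ := Ideal.exists_isMaximal_height (R := MvPolynomial σ ℂ)
  obtain ⟨y, rfl⟩ := MvPolynomial.eq_vanishingIdeal_singleton_of_isMaximal ℂ hm
  have hy : (pointIdeal y).height = Nat.card σ := WithBot.coe_injective (hmN.trans hN)
  let τ (c : σ → ℂ) : MvPolynomial σ ℂ →ₐ[ℂ] MvPolynomial σ ℂ :=
    MvPolynomial.aeval fun i => MvPolynomial.X i + MvPolynomial.C (c i)
  have hτ (c d : σ → ℂ) (hcd : ∀ i, c i + d i = 0) : (τ c).comp (τ d) = AlgHom.id ℂ _ := by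
    ext1 i
    have : MvPolynomial.C (c i) + MvPolynomial.C (d i) = (0 : MvPolynomial σ ℂ) := by
      rw [← MvPolynomial.C_add, hcd, MvPolynomial.C_0]
    simp only [τ, AlgHom.comp_apply, MvPolynomial.aeval_X, map_add, MvPolynomial.algHom_C,
      AlgHom.id_apply, add_assoc, MvPolynomial.algebraMap_eq, this, add_zero]
  let e : MvPolynomial σ ℂ ≃ₐ[ℂ] MvPolynomial σ ℂ :=
    AlgEquiv.ofAlgHom (τ (x - y)) (τ (y - x)) (hτ _ _ (by simp)) (hτ _ _ (by simp))
  have hcomap : (pointIdeal y).comap e.toRingEquiv = pointIdeal x := by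
    ext p
    rw [Ideal.mem_comap, mem_pointIdeal, mem_pointIdeal]
    have : (MvPolynomial.aeval y).comp (τ (x - y)) = (MvPolynomial.aeval x : _ →ₐ[ℂ] ℂ) := by
      ext1 i
      simp [τ]
    have h2 := DFunLike.congr_fun this p
    rw [← MvPolynomial.aeval_eq_eval, ← MvPolynomial.aeval_eq_eval]
    exact Eq.congr_left h2
  rw [← hcomap, ← hy]
  exact e.toRingEquiv.height_comap _

/-- The closed irreducible subset of the zero set of `s` defined by a prime containing `s`. -/
def irreducibleClosedsOfPrime [Finite σ] (s : Set (MvPolynomial σ ℂ))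
    (p : PrimeSpectrum.zeroLocus s) :
    IrreducibleCloseds {x : ZariskiSpace σ | ∀ f ∈ s, MvPolynomial.eval x f = 0} where
  carrier := {x | ∀ f ∈ p.1.asIdeal, MvPolynomial.eval x.1 f = 0}
  isIrreducible' := by
    have hps : s ⊆ p.1.asIdeal := p.2
    -- Nullstellensatz: a prime ideal is the full vanishing ideal of its zero set.
    have hvan : ∀ f : MvPolynomial σ ℂ, (∀ x : σ → ℂ, (∀ g ∈ p.1.asIdeal,
        MvPolynomial.eval x g = 0) → MvPolynomial.eval x f = 0) → f ∈ p.1.asIdeal := by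
      intro f hf
      rw [← MvPolynomial.IsPrime.vanishingIdeal_zeroLocus (K := ℂ) p.1.asIdeal]
      intro x hx
      rw [MvPolynomial.aeval_eq_eval]
      exact hf x fun g hg => by simpa [MvPolynomial.aeval_eq_eval] using hx g hg
    refine ⟨?_, ?_⟩
    · by_contra hne
      refine p.1.2.ne_top ((Ideal.eq_top_iff_one _).2 (hvan 1 fun x hx => ?_))
      exact (hne ⟨⟨x, fun f hf => hx f (hps hf)⟩, hx⟩).elim
    · rw [isPreirreducible_iff_isClosed_union_isClosed]
      intro Z₁ Z₂ h₁ h₂ hsub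
      obtain ⟨T₁, hT₁, rfl⟩ := isClosed_induced_iff.1 h₁
      obtain ⟨T₂, hT₂, rfl⟩ := isClosed_induced_iff.1 h₂
      obtain ⟨P₁, rfl⟩ := (isClosed_iff _).1 hT₁
      obtain ⟨P₂, rfl⟩ := (isClosed_iff _).1 hT₂
      by_contra! hcon
      obtain ⟨⟨x, hx, hx1⟩, ⟨y, hy, hy2⟩⟩ := hcon.imp Set.not_subset.1 Set.not_subset.1
      obtain ⟨f, hf, hfx⟩ : ∃ f ∈ P₁, MvPolynomial.eval x.1 f ≠ 0 := by
        by_contra! h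
        exact hx1 h
      obtain ⟨g, hg, hgy⟩ : ∃ f ∈ P₂, MvPolynomial.eval y.1 f ≠ 0 := by
        by_contra! h
        exact hy2 h
      have hfg : f * g ∈ p.1.asIdeal := by
        refine hvan _ fun z hz => ?_
        rw [map_mul, mul_eq_zero]
        exact (hsub (a := ⟨z, fun f hf => hz f (hps hf)⟩) hz).imp (fun h => h f hf)
          (fun h => h g hg)
      rcases p.1.2.mem_or_mem hfg with h | h
      · exact hfx (hx f h)
      · exact hgy (hy g h)
  isClosed' := isClosed_induced_iff.2
    ⟨_, (isClosed_iff {x | ∀ f ∈ p.1.asIdeal, MvPolynomial.eval x f = 0}).2 ⟨_, rfl⟩, rfl⟩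

theorem irreducibleClosedsOfPrime_le_iff [Finite σ] (s : Set (MvPolynomial σ ℂ))
    (p q : PrimeSpectrum.zeroLocus s) :
    irreducibleClosedsOfPrime s q ≤ irreducibleClosedsOfPrime s p ↔ p ≤ q := by
  change SetLike.coe (irreducibleClosedsOfPrime s q) ⊆ SetLike.coe (irreducibleClosedsOfPrime s p)
    ↔ p.1.asIdeal ≤ q.1.asIdeal
  refine ⟨fun h f hf => ?_, fun h x hx f hf => hx f (h hf)⟩
  rw [← MvPolynomial.IsPrime.vanishingIdeal_zeroLocus (K := ℂ) q.1.asIdeal]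
  intro x hx
  have hx' : ∀ g ∈ q.1.asIdeal, MvPolynomial.eval x g = 0 := fun g hg => by
    simpa [MvPolynomial.aeval_eq_eval] using hx g hg
  rw [MvPolynomial.aeval_eq_eval]
  exact h (a := ⟨x, fun g hg => hx' g (q.2 hg)⟩) hx' f hf

theorem irreducibleClosedsOfPrime_surjective [Finite σ] (s : Set (MvPolynomial σ ℂ)) :
    Function.Surjective (irreducibleClosedsOfPrime s) := by
  intro Z
  let I : Ideal (MvPolynomial σ ℂ) := MvPolynomial.vanishingIdeal ℂ (Subtype.val '' (Z : Set
    {x : ZariskiSpace σ | ∀ f ∈ s, MvPolynomial.eval x f = 0}) : Set (σ → ℂ))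
  have memI : ∀ f, f ∈ I ↔ ∀ x ∈ Z, MvPolynomial.eval x.1 f = 0 := by
    intro f
    constructor
    · intro h x hx
      exact h x.1 ⟨x, hx, rfl⟩
    · rintro h _ ⟨x, hx, rfl⟩
      exact h x hx
  have hI : I.IsPrime := by
    refine ⟨?_, ?_⟩
    · rw [Ideal.ne_top_iff_one]
      intro h
      obtain ⟨x, hx⟩ := Z.isIrreducible.nonempty
      simpa using (memI _).1 h x hx
    · intro f g hfg
      rw [memI, memI]
      exact isPreirreducible_iff_isClosed_union_isClosed.1 Z.isIrreducible.2
        _ _ ((isClosed_setOf_eval_eq_zero f).preimage continuous_subtype_val)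
        ((isClosed_setOf_eval_eq_zero g).preimage continuous_subtype_val) (by
          intro x hx
          have h0 := (memI _).1 hfg x hx
          rw [map_mul, mul_eq_zero] at h0
          exact h0)
  refine ⟨⟨⟨I, hI⟩, fun f hf => (memI f).2 fun x _ => x.2 f hf⟩,
    IrreducibleCloseds.ext (Set.Subset.antisymm ?_ ?_)⟩
  · intro x hx
    obtain ⟨T, hT, hTZ⟩ := isClosed_induced_iff.1 Z.isClosed
    obtain ⟨P, rfl⟩ := (isClosed_iff _).1 hT
    rw [← hTZ]
    intro f hf
    refine hx f ((memI f).2 fun y hy => ?_)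
    change y ∈ (Z : Set _) at hy
    rw [← hTZ] at hy
    exact hy f hf
  · intro x hx f hf
    exact (memI f).1 hf x hx

/-- The closed irreducible subsets of the zero set of `s` correspond to the primes containing
`s`. -/
def zeroLocusOrderIso [Finite σ] (s : Set (MvPolynomial σ ℂ)) :
    PrimeSpectrum.zeroLocus s ≃o
      (IrreducibleCloseds {x : ZariskiSpace σ | ∀ f ∈ s, MvPolynomial.eval x f = 0})ᵒᵈ :=
  RelIso.ofSurjective
    (OrderEmbedding.ofMapLEIff (fun p => OrderDual.toDual (irreducibleClosedsOfPrime s p))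
      (irreducibleClosedsOfPrime_le_iff s))
    (irreducibleClosedsOfPrime_surjective s)

/-- The correspondence between primes and irreducible closed sets reverses inclusion, so the
coheight of a point becomes the height of its maximal ideal in the quotient ring. -/
theorem localDim_zeroLocus_eq_height [Finite σ] (s : Set (MvPolynomial σ ℂ)) (x : ZariskiSpace σ)
    (hx : ∀ f ∈ s, MvPolynomial.eval x f = 0) :
    localDim {x : ZariskiSpace σ | ∀ f ∈ s, MvPolynomial.eval x f = 0} ⟨x, hx⟩ =
      ((pointIdeal x).map (Ideal.Quotient.mk (Ideal.span s))).height := by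
  have hle : Ideal.span s ≤ pointIdeal x :=
    Ideal.span_le.2 fun f hf => mem_pointIdeal.2 (hx f hf)
  have hmax : (pointIdeal x).IsPrime := (pointIdeal_isMaximal x).isPrime
  have hprime : ((pointIdeal x).map (Ideal.Quotient.mk (Ideal.span s))).IsPrime :=
    Ideal.isPrime_map_quotientMk_of_isPrime hle
  let φ := (Ideal.primeSpectrumQuotientOrderIsoZeroLocus (Ideal.span s)).trans
    ((OrderIso.setCongr _ _ (PrimeSpectrum.zeroLocus_span s)).trans (zeroLocusOrderIso s))
  have h := Order.height_orderIso φ ⟨_, hprime⟩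
  rw [← PrimeSpectrum.height_eq_orderHeight] at h
  rw [← h, localDim, ← Order.height_toDual]
  congr 1
  refine congrArg OrderDual.toDual (IrreducibleCloseds.ext (Set.ext fun y => ?_))
  change y = ⟨x, hx⟩ ↔ ∀ f ∈ ((pointIdeal x).map (Ideal.Quotient.mk (Ideal.span s))).comap
    (Ideal.Quotient.mk (Ideal.span s)), MvPolynomial.eval y.1 f = 0
  rw [Ideal.comap_map_mk hle]
  constructor
  · rintro rfl f hf
    exact mem_pointIdeal.1 hf
  · intro h
    refine Subtype.ext (funext fun i => ?_)
    have := h (MvPolynomial.X i - MvPolynomial.C (x i)) (X_sub_C_mem_pointIdeal x i)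
    rw [map_sub, sub_eq_zero] at this
    exact (MvPolynomial.eval_X (f := y.1) i).symm.trans (this.trans (MvPolynomial.eval_C _))

/-! ### Gradients and the Jacobian criterion -/

/-- The gradient of a polynomial at a point. -/
def gradient (x : σ → ℂ) : MvPolynomial σ ℂ →ₗ[ℂ] (σ → ℂ) :=
  LinearMap.pi fun i => (MvPolynomial.aeval x).toLinearMap ∘ₗ (MvPolynomial.pderiv i).toLinearMap

theorem gradient_apply (x : σ → ℂ) (p : MvPolynomial σ ℂ) (i : σ) :
    gradient x p i = MvPolynomial.eval x (MvPolynomial.pderiv i p) := by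
  simp [gradient, MvPolynomial.aeval_eq_eval]

theorem gradient_mul (x : σ → ℂ) (p q : MvPolynomial σ ℂ) :
    gradient x (p * q) =
      MvPolynomial.eval x p • gradient x q + MvPolynomial.eval x q • gradient x p := by
  ext i
  simp [gradient_apply]

theorem gradient_C (x : σ → ℂ) (c : ℂ) : gradient x (MvPolynomial.C c) = 0 := by
  ext i
  simp [gradient_apply]

theorem gradient_X [DecidableEq σ] (x : σ → ℂ) (i : σ) :
    gradient x (MvPolynomial.X i) = Pi.single i 1 := by
  ext j
  simp only [gradient_apply, MvPolynomial.pderiv_X]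
  rcases eq_or_ne i j with rfl | h
  · simp
  · simp [h, h.symm]

/-- First order Taylor expansion at a point. -/
theorem sub_taylor_mem_sq [Fintype σ] (x : σ → ℂ) (p : MvPolynomial σ ℂ) :
    p - MvPolynomial.C (MvPolynomial.eval x p) - ∑ i, MvPolynomial.C (gradient x p i) *
      (MvPolynomial.X i - MvPolynomial.C (x i)) ∈ pointIdeal x ^ 2 := by
  classical
  have hX : ∀ i, (MvPolynomial.X i - MvPolynomial.C (x i) : MvPolynomial σ ℂ) ∈ pointIdeal x :=
    X_sub_C_mem_pointIdeal x
  induction p using MvPolynomial.induction_on with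
  | C a => simp [gradient_C]
  | add p q hp hq =>
    convert add_mem hp hq using 1
    simp only [map_add, Pi.add_apply, add_mul, Finset.sum_add_distrib]
    ring
  | mul_X p j hp =>
    have h1 : (p - MvPolynomial.C (MvPolynomial.eval x p)) *
        (MvPolynomial.X j - MvPolynomial.C (x j)) ∈ pointIdeal x ^ 2 := by
      rw [pow_two]
      exact Ideal.mul_mem_mul (mem_pointIdeal.2 (by simp)) (hX j)
    -- The remainder of `p * X j` is `(p - p(x)) (X j - x j)` plus `x j` times the remainder of `p`.
    convert add_mem h1 (Ideal.mul_mem_left _ (MvPolynomial.C (x j)) hp) using 1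
    have : ∀ i, gradient x (p * MvPolynomial.X j) i =
        MvPolynomial.eval x p * (Pi.single j 1 : σ → ℂ) i + x j * gradient x p i := by
      intro i
      rw [gradient_mul, gradient_X]
      simp
    simp only [this, map_add, map_mul, add_mul, Finset.sum_add_distrib, MvPolynomial.eval_X]
    rw [Finset.sum_eq_single j (by intro i _ hij; simp [hij]) (by simp)]
    simp only [mul_sub, Finset.mul_sum, mul_assoc, Pi.single_eq_same, MvPolynomial.C_1, one_mul]
    ring

/-- If the gradients at `x` of the polynomials in `t` vanishing at `x` span, then no prime
strictly inside the ideal of `x` contains `t`. -/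
theorem pointIdeal_le_of_gradient_span [Fintype σ] (x : σ → ℂ)
    (t : Set (MvPolynomial σ ℂ)) (ht : t ⊆ pointIdeal x)
    (hspan : ⊤ ≤ Submodule.span ℂ (gradient x '' t)) {p : Ideal (MvPolynomial σ ℂ)}
    (hp : p.IsPrime) (htp : t ⊆ p) (hpx : p ≤ pointIdeal x) : pointIdeal x ≤ p := by
  -- By the Taylor expansion, the spanning gradients give `𝔪 ⊆ (t) + 𝔪²`.
  have hle : pointIdeal x ≤ Ideal.span t ⊔ pointIdeal x • pointIdeal x := by
    intro f hf
    have hg : gradient x f ∈ Submodule.span ℂ (gradient x '' t) := hspan trivial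
    rw [Submodule.span_image, Submodule.mem_map] at hg
    obtain ⟨g, hg, hgf⟩ := hg
    have hg' : g ∈ Ideal.span t := by
      have : Submodule.span ℂ t ≤ (Ideal.span t).restrictScalars ℂ :=
        Submodule.span_le.2 Ideal.subset_span
      exact this hg
    have h0 : MvPolynomial.eval x (f - g) = 0 := by
      rw [map_sub, mem_pointIdeal.1 hf, mem_pointIdeal.1 (Ideal.span_le.2 ht hg'), sub_zero]
    have h := sub_taylor_mem_sq x (f - g)
    rw [h0, map_sub, hgf, sub_self] at h
    simp only [map_zero, Pi.zero_apply, zero_mul, Finset.sum_const_zero, sub_zero] at h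
    rw [pow_two] at h
    rw [← add_sub_cancel g f]
    exact add_mem (Submodule.mem_sup_left hg') (Submodule.mem_sup_right h)
  -- Nakayama: some `r ≡ 1` modulo `𝔪` satisfies `r 𝔪 ⊆ (t) ⊆ p`. Since `p ⊆ 𝔪`, `r` is outside the
  -- prime `p` and can be cancelled.
  obtain ⟨r, hr, hrle⟩ := Submodule.exists_sub_one_mem_and_smul_le_of_fg_of_le_sup
    (IsNoetherian.noetherian (pointIdeal x)) (le_refl _) hle
  have hrx : r ∉ pointIdeal x := fun h => (pointIdeal_isMaximal x).ne_top
    ((Ideal.eq_top_iff_one _).2 (by simpa using sub_mem h hr))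
  intro f hf
  refine (hp.mem_or_mem (Ideal.span_le.2 htp (hrle ?_))).resolve_left fun h => hrx (hpx h)
  exact Submodule.smul_mem_pointwise_smul f r _ hf

/-- Upper bound: completing the gradients to a basis by coordinate functions makes the point ideal
minimal, in the quotient, over at most `card σ - m` elements, and Krull's height theorem applies.
Lower bound: `m` equations lower the height of the point ideal by at most `m`. -/
theorem localDim_zeroLocus_of_linearIndependent [Fintype σ] {m : ℕ}
    (f : Fin m → MvPolynomial σ ℂ) (x : ZariskiSpace σ)
    (hx : ∀ g ∈ Set.range f, MvPolynomial.eval x g = 0)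
    (hf : LinearIndependent ℂ fun j => gradient x (f j)) :
    m ≤ Fintype.card σ ∧
    localDim {x : ZariskiSpace σ | ∀ g ∈ Set.range f, MvPolynomial.eval x g = 0} ⟨x, hx⟩ =
      ((Fintype.card σ - m : ℕ) : ℕ∞) := by
  classical
  have hm : m ≤ Fintype.card σ := by simpa using hf.fintype_card_le_finrank
  refine ⟨hm, ?_⟩
  rw [localDim_zeroLocus_eq_height]
  have hfx : Ideal.span (Set.range f) ≤ pointIdeal x :=
    Ideal.span_le.2 fun g hg => mem_pointIdeal.2 (hx g hg)
  have hprime : (pointIdeal x).IsPrime := (pointIdeal_isMaximal x).isPrime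
  apply le_antisymm
  · let w : Fin m ⊕ σ → MvPolynomial σ ℂ :=
      Sum.elim f fun i => MvPolynomial.X i - MvPolynomial.C (x i)
    have hwx : ∀ k, w k ∈ pointIdeal x := by
      rintro (j | i)
      · exact mem_pointIdeal.2 (hx _ ⟨j, rfl⟩)
      · exact X_sub_C_mem_pointIdeal x i
    have hs : LinearIndepOn ℂ (gradient x ∘ w) (Set.range Sum.inl) :=
      (linearIndepOn_range_iff Sum.inl_injective _).2 hf
    obtain ⟨b, -, hsb, hspan, hb⟩ := exists_linearIndepOn_extension hs (Set.subset_univ _)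
    have hspan' : ⊤ ≤ Submodule.span ℂ (gradient x '' (w '' b)) := by
      rw [← Set.image_comp, ← (Pi.basisFun ℂ σ).span_eq]
      refine Submodule.span_le.2 ?_
      rintro _ ⟨i, rfl⟩
      refine hspan ⟨Sum.inr i, trivial, ?_⟩
      rw [Pi.basisFun_apply, ← gradient_X x i, Function.comp_apply]
      change gradient x (MvPolynomial.X i - MvPolynomial.C (x i)) = _
      rw [map_sub]
      exact (congrArg _ (gradient_C x (x i))).trans (sub_zero _)
    have hcard : b.ncard ≤ Fintype.card σ := by
      have := hb.encard_le_toENat_rank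
      rw [rank_fun', ← b.toFinite.cast_ncard_eq, map_natCast] at this
      exact_mod_cast this
    have hdiff : (b \ Set.range Sum.inl).ncard ≤ Fintype.card σ - m := by
      rw [Set.ncard_sdiff hsb, ← Set.image_univ,
        Set.ncard_image_of_injective _ Sum.inl_injective]
      simpa using Nat.sub_le_sub_right hcard m
    let mk := Ideal.Quotient.mk (Ideal.span (Set.range f))
    have hmin : (pointIdeal x).map mk ∈
        (Ideal.span ((mk ∘ w) '' (b \ Set.range Sum.inl))).minimalPrimes := by
      refine ⟨⟨Ideal.isPrime_map_quotientMk_of_isPrime hfx, Ideal.span_le.2 ?_⟩, ?_⟩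
      · rintro _ ⟨k, -, rfl⟩
        exact Ideal.mem_map_of_mem _ (hwx k)
      · rintro q ⟨hq, hqb⟩ hqx
        have hq' : q.comap mk ≤ pointIdeal x := by
          rw [← Ideal.comap_map_mk hfx]
          exact Ideal.comap_mono hqx
        have := pointIdeal_le_of_gradient_span x (w '' b)
          (by rintro _ ⟨k, -, rfl⟩; exact hwx k) hspan' (hq.comap mk) (by
            rintro _ ⟨k, hk, rfl⟩
            by_cases hk' : k ∈ Set.range Sum.inl
            · obtain ⟨j, rfl⟩ := hk'
              change mk (f j) ∈ q
              rw [Ideal.Quotient.eq_zero_iff_mem.2 (Ideal.subset_span (Set.mem_range_self j))]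
              exact zero_mem _
            · exact hqb (Ideal.subset_span ⟨k, ⟨hk, hk'⟩, rfl⟩)) hq'
        exact Ideal.map_le_iff_le_comap.2 this
    refine (Ideal.height_le_card_of_mem_minimalPrimes_span (Set.toFinite _) hmin).trans ?_
    exact_mod_cast (Set.ncard_image_le (Set.toFinite _)).trans hdiff
  · have h := Ideal.height_le_height_add_encard_of_subset (Set.range f) (p := pointIdeal x)
      fun g hg => mem_pointIdeal.2 (hx g hg)
    rw [pointIdeal_height_eq x, Nat.card_eq_fintype_card] at h
    have hle : (Set.range f).encard ≤ m := by
      rw [← Set.image_univ]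
      refine (Set.encard_image_le _ _).trans ?_
      simp
    rw [ENat.natCast_sub]
    exact tsub_le_iff_right.2 (h.trans (by gcongr))

end ZariskiSpace

/-! ### Regular functions -/

/-- A function on affine space is regular on `X` if it is given on `X` by a quotient of polynomials
with nowhere vanishing denominator. -/
def RegularOn {σ : Type} (X : Set (ZariskiSpace σ)) (f : ZariskiSpace σ → ℂ) : Prop :=
  ∃ p h : MvPolynomial σ ℂ, ∀ x ∈ X, MvPolynomial.eval x h ≠ 0 ∧
    f x = MvPolynomial.eval x p / MvPolynomial.eval x h

namespace RegularOn

variable {σ τ : Type} {X : Set (ZariskiSpace σ)} {f g : ZariskiSpace σ → ℂ}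

theorem eval (p : MvPolynomial σ ℂ) : RegularOn X fun x => MvPolynomial.eval x p :=
  ⟨p, 1, fun x _ => by simp [map_one (MvPolynomial.eval (R := ℂ) x)]⟩

theorem congr (hf : RegularOn X f) (h : ∀ x ∈ X, g x = f x) : RegularOn X g := by
  obtain ⟨p, d, hp⟩ := hf
  exact ⟨p, d, fun x hx => ⟨(hp x hx).1, (h x hx).trans (hp x hx).2⟩⟩

theorem const (c : ℂ) : RegularOn X fun _ => c :=
  (eval (MvPolynomial.C c)).congr fun _ _ => (MvPolynomial.eval_C c).symm

theorem mono {Y : Set (ZariskiSpace σ)} (hf : RegularOn X f) (h : Y ⊆ X) : RegularOn Y f := by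
  obtain ⟨p, d, hp⟩ := hf
  exact ⟨p, d, fun x hx => hp x (h hx)⟩

theorem add (hf : RegularOn X f) (hg : RegularOn X g) : RegularOn X fun x => f x + g x := by
  obtain ⟨p, d, hp⟩ := hf
  obtain ⟨q, e, hq⟩ := hg
  refine ⟨p * e + d * q, d * e, fun x hx => ?_⟩
  obtain ⟨h1, h2⟩ := hp x hx
  obtain ⟨h3, h4⟩ := hq x hx
  simp only [map_mul, map_add]
  exact ⟨mul_ne_zero h1 h3, by rw [h2, h4, div_add_div _ _ h1 h3]⟩

theorem mul (hf : RegularOn X f) (hg : RegularOn X g) : RegularOn X fun x => f x * g x := by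
  obtain ⟨p, d, hp⟩ := hf
  obtain ⟨q, e, hq⟩ := hg
  refine ⟨p * q, d * e, fun x hx => ?_⟩
  obtain ⟨h1, h2⟩ := hp x hx
  obtain ⟨h3, h4⟩ := hq x hx
  simp only [map_mul]
  exact ⟨mul_ne_zero h1 h3, by rw [h2, h4, div_mul_div_comm]⟩

theorem inv (hf : RegularOn X f) (h : ∀ x ∈ X, f x ≠ 0) : RegularOn X fun x => (f x)⁻¹ := by
  obtain ⟨p, d, hp⟩ := hf
  refine ⟨d, p, fun x hx => ?_⟩
  obtain ⟨h1, h2⟩ := hp x hx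
  refine ⟨fun h0 => h x hx (by rw [h2, h0, zero_div]), (congrArg _ h2).trans (inv_div _ _)⟩

theorem sum {ι : Type*} (s : Finset ι) {f : ι → ZariskiSpace σ → ℂ}
    (h : ∀ i ∈ s, RegularOn X (f i)) : RegularOn X fun x => ∑ i ∈ s, f i x := by
  classical
  induction s using Finset.induction_on with
  | empty => simpa using const 0
  | insert a s ha ih =>
    simp only [Finset.sum_insert ha]
    exact (h a (by simp)).add (ih fun i hi => h i (by simp [hi]))

theorem prod {ι : Type*} (s : Finset ι) {f : ι → ZariskiSpace σ → ℂ}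
    (h : ∀ i ∈ s, RegularOn X (f i)) : RegularOn X fun x => ∏ i ∈ s, f i x := by
  classical
  induction s using Finset.induction_on with
  | empty => simpa using const 1
  | insert a s ha ih =>
    simp only [Finset.prod_insert ha]
    exact (h a (by simp)).mul (ih fun i hi => h i (by simp [hi]))

theorem isOpen_ne_zero (hf : RegularOn X f) (hX : IsOpen X) : IsOpen {x | x ∈ X ∧ f x ≠ 0} := by
  obtain ⟨p, d, hp⟩ := hf
  convert hX.inter (ZariskiSpace.isOpen_setOf_eval_ne_zero p) using 1
  ext x
  refine and_congr_right fun hx => ?_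
  rw [(hp x hx).2, div_ne_zero_iff]
  exact and_iff_left (hp x hx).1

theorem eval_comp {φ : ZariskiSpace σ → ZariskiSpace τ} (hφ : ∀ i, RegularOn X fun x => φ x i)
    (p : MvPolynomial τ ℂ) : RegularOn X fun x => MvPolynomial.eval (φ x) p := by
  induction p using MvPolynomial.induction_on with
  | C a => exact (const a).congr fun x _ => MvPolynomial.eval_C _
  | add p q hp hq => exact (hp.add hq).congr fun x _ => map_add _ _ _
  | mul_X p i hp =>
    exact (hp.mul (hφ i)).congr fun x _ => (map_mul _ _ _).trans
      (congrArg _ (MvPolynomial.eval_X _))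

/-- Pulling back a polynomial gives a fraction, so the preimage of a zero locus is the zero locus of
the numerators. -/
theorem continuousOn {φ : ZariskiSpace σ → ZariskiSpace τ} (hφ : ∀ i, RegularOn X fun x => φ x i) :
    ContinuousOn φ X := by
  rw [continuousOn_iff_isClosed]
  intro t ht
  obtain ⟨P, rfl⟩ := (ZariskiSpace.isClosed_iff t).1 ht
  choose num den h using fun p => eval_comp hφ p
  refine ⟨_, (ZariskiSpace.isClosed_iff _).2 ⟨num '' P, rfl⟩, ?_⟩
  ext x
  refine and_congr_left fun hx => ?_
  change (∀ p ∈ P, MvPolynomial.eval (φ x) p = 0) ↔ ∀ p ∈ num '' P, MvPolynomial.eval x p = 0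
  rw [Set.forall_mem_image]
  refine forall₂_congr fun p _ => ?_
  refine (Eq.congr_left (h p x hx).2).trans ?_
  rw [div_eq_zero_iff]
  exact or_iff_left (h p x hx).1

end RegularOn

/-! ### Regular maps into vector spaces and algebras -/

/-- A vector valued function is regular if its composition with every linear functional is. -/
def VecRegularOn {σ : Type} (X : Set (ZariskiSpace σ)) {M : Type*} [AddCommGroup M] [Module ℂ M]
    (F : ZariskiSpace σ → M) : Prop :=
  ∀ φ : M →ₗ[ℂ] ℂ, RegularOn X fun x => φ (F x)

namespace VecRegularOn

variable {σ τ : Type} {X : Set (ZariskiSpace σ)} {M M' : Type*} [AddCommGroup M] [Module ℂ M]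
  [AddCommGroup M'] [Module ℂ M'] {F G : ZariskiSpace σ → M}

theorem const (c : M) : VecRegularOn X fun _ => c := fun φ => .const (φ c)

theorem congr (hf : VecRegularOn X F) (h : ∀ x ∈ X, G x = F x) : VecRegularOn X G :=
  fun φ => (hf φ).congr fun x hx => by rw [h x hx]

theorem add (hF : VecRegularOn X F) (hG : VecRegularOn X G) : VecRegularOn X fun x => F x + G x :=
  fun φ => ((hF φ).add (hG φ)).congr fun _ _ => map_add _ _ _

theorem map (L : M →ₗ[ℂ] M') (hF : VecRegularOn X F) : VecRegularOn X fun x => L (F x) :=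
  fun φ => hF (φ ∘ₗ L)

theorem sub (hF : VecRegularOn X F) (hG : VecRegularOn X G) : VecRegularOn X fun x => F x - G x :=
  (hF.add (hG.map (-LinearMap.id))).congr fun x _ => by simp [sub_eq_add_neg]

theorem of_linear [Finite σ] (L : (σ → ℂ) →ₗ[ℂ] M) :
    VecRegularOn X (fun x : ZariskiSpace σ => L x) := by
  classical
  have := Fintype.ofFinite σ
  intro φ
  refine (RegularOn.sum Finset.univ fun i _ => (RegularOn.eval (X := X)
    (MvPolynomial.X i)).mul (RegularOn.const (φ (L (Pi.single i 1))))).congr fun x _ => ?_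
  have := congrArg (φ ∘ₗ L) (pi_eq_sum_univ' x)
  refine this.trans ?_
  rw [map_sum]
  refine Finset.sum_congr rfl fun i _ => ?_
  rw [map_smul, smul_eq_mul, mul_comm, mul_comm]
  exact congrArg₂ _ (MvPolynomial.eval_X i).symm rfl

theorem of_basis {κ : Type*} [Fintype κ] (b : Module.Basis κ ℂ M)
    (h : ∀ k, RegularOn X fun x => b.repr (F x) k) : VecRegularOn X F := by
  intro φ
  refine (RegularOn.sum Finset.univ fun k _ => (h k).mul (.const (φ (b k)))).congr fun x _ => ?_
  exact (congrArg φ (b.sum_repr (F x))).symm.trans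
    (by simp only [map_sum, map_smul, smul_eq_mul])

theorem smul {f : ZariskiSpace σ → ℂ} (hf : RegularOn X f) (hF : VecRegularOn X F) :
    VecRegularOn X fun x => f x • F x :=
  fun φ => (hf.mul (hF φ)).congr fun _ _ => map_smul _ _ _

theorem mul {R : Type*} [Ring R] [Algebra ℂ R] [FiniteDimensional ℂ R] {F G : ZariskiSpace σ → R}
    (hF : VecRegularOn X F) (hG : VecRegularOn X G) : VecRegularOn X fun x => F x * G x := by
  intro φ
  let b := Module.finBasis ℂ R
  refine (RegularOn.sum Finset.univ fun i _ => RegularOn.sum Finset.univ fun j _ =>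
    ((hF (b.coord i)).mul (hG (b.coord j))).mul (.const (φ (b i * b j)))).congr fun x _ => ?_
  exact (congrArg φ (congrArg₂ _ (b.sum_repr (F x)) (b.sum_repr (G x)))).symm.trans
    (by simp only [Finset.sum_mul_sum, map_sum, smul_mul_smul_comm, map_smul, smul_eq_mul,
      Module.Basis.coord_apply])

variable {k : Type*} [Fintype k] [DecidableEq k] {A : ZariskiSpace σ → Matrix k k ℂ}

theorem entry {k l : Type*} {A : ZariskiSpace σ → Matrix k l ℂ} (hA : VecRegularOn X A)
    (i : k) (j : l) : RegularOn X fun x => A x i j :=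
  hA (Matrix.entryLinearMap ℂ ℂ i j)

theorem matrix (h : ∀ i j, RegularOn X fun x => A x i j) : VecRegularOn X A := by
  intro φ
  refine (RegularOn.sum Finset.univ fun i _ => RegularOn.sum Finset.univ fun j _ =>
    (h i j).mul (.const (φ (Matrix.single i j 1)))).congr fun x _ => ?_
  refine (congrArg φ (Matrix.matrix_eq_sum_single (A x))).trans ?_
  simp only [map_sum, ← smul_eq_mul, ← map_smul, Matrix.smul_single]
  simp only [smul_eq_mul, mul_one]

theorem det (h : ∀ i j, RegularOn X fun x => A x i j) : RegularOn X fun x => (A x).det := by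
  simp only [Matrix.det_apply']
  exact .sum _ fun s _ => (RegularOn.const _).mul (.prod _ fun i _ => h _ _)

theorem matrix_inv (hA : VecRegularOn X A) (hdet : ∀ x ∈ X, (A x).det ≠ 0) :
    VecRegularOn X fun x => (A x)⁻¹ := by
  simp only [Matrix.inv_def, Ring.inverse_eq_inv']
  refine smul ((det hA.entry).inv hdet) (matrix fun i j => ?_)
  simp only [Matrix.adjugate_apply]
  refine det fun i' j' => ?_
  by_cases h : i' = j
  · subst h
    simpa using RegularOn.const _
  · simpa [h] using hA.entry i' j'

end VecRegularOn

/-- The norm of an element of a finite dimensional algebra is nonzero exactly for units. -/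
theorem isUnit_iff_det_leftMulMatrix_ne_zero {R κ : Type*} [Ring R] [Algebra ℂ R] [Fintype κ]
    [DecidableEq κ] (b : Module.Basis κ ℂ R) (g : R) :
    IsUnit g ↔ (Algebra.leftMulMatrix b g).det ≠ 0 := by
  rw [← isUnit_iff_ne_zero, ← Matrix.isUnit_iff_isUnit_det]
  refine ⟨fun h => h.map _, fun h => ?_⟩
  rw [Algebra.leftMulMatrix_apply] at h
  have hu : IsUnit (Algebra.lmul ℂ R g) := (isUnit_map_iff (LinearMap.toMatrixAlgEquiv b) _).1 h
  have hbij := (Module.End.isUnit_iff _).1 hu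
  obtain ⟨g', hg'⟩ := hbij.2 1
  have hg'' : g * g' = 1 := hg'
  refine ⟨⟨g, g', hg'', hbij.1 ?_⟩, rfl⟩
  change g * (g' * g) = g * 1
  rw [← mul_assoc, hg'', one_mul, mul_one]

/-- The regular representation embeds `R` in a matrix algebra, where inversion is rational by the
adjugate formula; a linear left inverse of the embedding brings the result back. -/
theorem VecRegularOn.ringInverse {σ : Type} {X : Set (ZariskiSpace σ)} {R : Type*} [Ring R]
    [Algebra ℂ R] [FiniteDimensional ℂ R] {F : ZariskiSpace σ → R} (hF : VecRegularOn X F)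
    (h : ∀ x ∈ X, IsUnit (F x)) : VecRegularOn X fun x => Ring.inverse (F x) := by
  let b := Module.finBasis ℂ R
  obtain ⟨K, hK⟩ := LinearMap.exists_leftInverse_of_injective
    (Algebra.leftMulMatrix b).toLinearMap (LinearMap.ker_eq_bot.2 (Algebra.leftMulMatrix_injective b))
  refine (((hF.map (Algebra.leftMulMatrix b).toLinearMap).matrix_inv fun x hx =>
    (isUnit_iff_det_leftMulMatrix_ne_zero b _).1 (h x hx)).map K).congr fun x hx => ?_
  rw [Matrix.inv_eq_right_inv (B := Algebra.leftMulMatrix b (Ring.inverse (F x)))]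
  · exact (LinearMap.congr_fun hK _).symm
  · rw [AlgHom.toLinearMap_apply, ← map_mul, Ring.mul_inverse_cancel _ (h x hx), map_one]

/-! ### Slices: rational charts of conjugacy classes -/

section Slice

variable {R : Type*} [Ring R] [Algebra ℂ R]

/-- The map `x ↦ x a - b x`. -/
def intertwiner (a b : R) : R →ₗ[ℂ] R := LinearMap.mulRight ℂ a - LinearMap.mulLeft ℂ b

@[simp]
theorem intertwiner_apply (a b x : R) : intertwiner a b x = x * a - b * x := rfl

/-- By rank-nullity, a complement of the centralizer has the dimension of the image of `x ↦ x a - a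
x`, the tangent space of the class at `a`. -/
theorem exists_slice [FiniteDimensional ℂ R] (a : R) :
    ∃ ι : (Fin (Module.finrank ℂ (LinearMap.range (intertwiner a a))) → ℂ) →ₗ[ℂ] R,
      Function.Injective ι ∧ IsCompl (LinearMap.range ι) (LinearMap.ker (intertwiner a a)) := by
  obtain ⟨S, hS⟩ := Submodule.exists_isCompl (LinearMap.ker (intertwiner a a))
  have h1 := LinearMap.finrank_range_add_finrank_ker (intertwiner a a)
  have h2 := Submodule.finrank_add_eq_of_isCompl hS
  have h3 : Module.finrank ℂ S = Module.finrank ℂ (LinearMap.range (intertwiner a a)) := by omega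
  let b := Module.finBasisOfFinrankEq ℂ S h3
  refine ⟨S.subtype ∘ₗ b.equivFun.symm.toLinearMap,
    S.injective_subtype.comp b.equivFun.symm.injective, ?_⟩
  rw [LinearMap.range_comp, LinearEquiv.range, Submodule.map_top, Submodule.range_subtype]
  exact hS.symm

variable {N : ℕ} (ι : (Fin N → ℂ) →ₗ[ℂ] R)

/-- The conjugate of `a` by `1 + ι v`. -/
def slicePoint (a : R) (v : Fin N → ℂ) : R := (1 + ι v) * a * Ring.inverse (1 + ι v)

theorem slicePoint_zero (a : R) : slicePoint ι a 0 = a := by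
  simp [slicePoint]

theorem slicePoint_mul (a : R) {v : Fin N → ℂ} (hv : IsUnit (1 + ι v)) :
    slicePoint ι a v * (1 + ι v) = (1 + ι v) * a := by
  rw [slicePoint, mul_assoc, Ring.inverse_mul_cancel _ hv, mul_one]

/-- Clearing the inverse turns the chart equation into one that is affine linear in `v`, hence
solvable by rational functions of `b`. -/
theorem eq_slicePoint_iff {a b : R} {v : Fin N → ℂ} (hv : IsUnit (1 + ι v)) :
    b = slicePoint ι a v ↔ intertwiner a b (ι v) = b - a := by
  have : intertwiner a b (ι v) = b - a ↔ (1 + ι v) * a = b * (1 + ι v) := by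
    rw [intertwiner_apply, sub_eq_sub_iff_add_eq_add, add_mul, mul_add, one_mul, mul_one,
      add_comm]
  rw [this]
  constructor
  · rintro rfl
    exact (slicePoint_mul ι a hv).symm
  · intro h
    rw [slicePoint, h, mul_assoc, Ring.mul_inverse_cancel _ hv, mul_one]

variable (P : R →ₗ[ℂ] (Fin N → ℂ)) (a : R)

/-- The matrix of `w ↦ P (ι w a - b ι w)`. -/
def sliceMatrix (b : R) : Matrix (Fin N) (Fin N) ℂ :=
  LinearMap.toMatrix' (P ∘ₗ intertwiner a b ∘ₗ ι)

/-- The local inverse of `slicePoint`. -/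
def sliceCoord (b : R) : Fin N → ℂ := (sliceMatrix ι P a b)⁻¹.mulVec (P (b - a))

theorem sliceMatrix_mulVec (b : R) (w : Fin N → ℂ) :
    (sliceMatrix ι P a b).mulVec w = P (intertwiner a b (ι w)) := by
  rw [sliceMatrix, LinearMap.toMatrix'_mulVec]
  rfl

variable {ι P a}

theorem eq_sliceCoord {b : R} (hb : (sliceMatrix ι P a b).det ≠ 0) {w : Fin N → ℂ}
    (hw : intertwiner a b (ι w) = b - a) : w = sliceCoord ι P a b := by
  rw [sliceCoord, ← hw, ← sliceMatrix_mulVec, Matrix.mulVec_mulVec,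
    Matrix.nonsing_inv_mul _ (isUnit_iff_ne_zero.2 hb), Matrix.one_mulVec]

/-- `sliceCoord` solves only the projection by `P` of the equation. If `b = h a h⁻¹`, the solutions
of `x a = b x` contain `h` times the centralizer of `a`. This meets `range ι` trivially since the
slice matrix is invertible, so by dimension it is a complement. Writing `1 = ι w + k` shows that
`-w` solves the full equation, and uniqueness identifies it with `sliceCoord`. -/
theorem intertwiner_sliceCoord [FiniteDimensional ℂ R]
    (hc : IsCompl (LinearMap.range ι) (LinearMap.ker (intertwiner a a))) {b : R}
    (hb : (sliceMatrix ι P a b).det ≠ 0) (hab : ∃ h : Rˣ, b = h * a * (h⁻¹ : Rˣ)) :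
    intertwiner a b (ι (sliceCoord ι P a b)) = b - a := by
  obtain ⟨h, rfl⟩ := hab
  set b := h * a * (h⁻¹ : Rˣ) with hbdef
  have hbh : b * h = h * a := by simp [hbdef, mul_assoc]
  let K := (LinearMap.ker (intertwiner a a)).map (LinearMap.mulLeft ℂ (h : R))
  have hK : ∀ x ∈ K, intertwiner a b x = 0 := by
    rintro _ ⟨z, hz, rfl⟩
    have hz' : z * a - a * z = 0 := hz
    rw [LinearMap.mulLeft_apply, intertwiner_apply, ← mul_assoc, hbh, mul_assoc, mul_assoc,
      ← mul_sub, hz', mul_zero]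
  have hdisj : Disjoint (LinearMap.range ι) K := by
    rw [Submodule.disjoint_def]
    rintro _ ⟨w, rfl⟩ hw
    have h0 := sliceMatrix_mulVec ι P a b w
    rw [hK _ hw, map_zero] at h0
    rw [Matrix.eq_zero_of_mulVec_eq_zero hb h0, map_zero]
  have hfin : Module.finrank ℂ K = Module.finrank ℂ (LinearMap.ker (intertwiner a a)) := by
    refine (LinearEquiv.finrank_eq (Submodule.equivMapOfInjective _ ?_ _)).symm
    intro x y hxy
    exact h.isUnit.mul_left_cancel hxy
  have htop : LinearMap.range ι ⊔ K = ⊤ := by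
    refine Submodule.eq_top_of_disjoint _ _ ?_ hdisj
    rw [hfin, Submodule.finrank_add_eq_of_isCompl hc]
  obtain ⟨_, ⟨w, rfl⟩, k, hk, hwk⟩ := Submodule.mem_sup.1 (htop ▸ Submodule.mem_top : (1 : R) ∈ _)
  have hw : intertwiner a b (ι (-w)) = b - a := by
    have := congrArg (intertwiner a b) hwk
    rw [map_add, hK k hk, add_zero] at this
    rw [map_neg, map_neg, this, intertwiner_apply, one_mul, mul_one, neg_sub]
  rwa [← eq_sliceCoord hb hw]

section

variable {σ : Type} {X : Set (ZariskiSpace σ)} [FiniteDimensional ℂ R]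

theorem VecRegularOn.sliceMatrix {F : ZariskiSpace σ → R} (hF : VecRegularOn X F) :
    VecRegularOn X fun x => sliceMatrix ι P a (F x) := by
  refine .matrix fun i j => ?_
  have : VecRegularOn X fun x => ι (Pi.single j 1) * a - F x * ι (Pi.single j 1) :=
    (VecRegularOn.const _).sub (hF.mul (.const _))
  exact (this.map P (LinearMap.proj i)).congr fun x _ => by
    simp [_root_.sliceMatrix, LinearMap.toMatrix'_apply]

theorem VecRegularOn.sliceCoord {F : ZariskiSpace σ → R} (hF : VecRegularOn X F)
    (h : ∀ x ∈ X, (_root_.sliceMatrix ι P a (F x)).det ≠ 0) :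
    VecRegularOn X fun x => sliceCoord ι P a (F x) := by
  refine .of_basis (Pi.basisFun ℂ (Fin N)) fun i => ?_
  have h1 := (hF.sliceMatrix (ι := ι) (P := P) (a := a)).matrix_inv h
  have h2 := (hF.sub (.const a)).map P
  exact (RegularOn.sum Finset.univ fun j _ => (h1.entry i j).mul (h2 (LinearMap.proj j))).congr
    fun x _ => rfl

theorem VecRegularOn.slicePoint {F : ZariskiSpace σ → (Fin N → ℂ)} (hF : VecRegularOn X F)
    (h : ∀ x ∈ X, IsUnit (1 + ι (F x))) :
    VecRegularOn X fun x => slicePoint ι a (F x) := by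
  have h1 := (VecRegularOn.const 1).add (hF.map ι)
  exact (h1.mul (.const a)).mul (h1.ringInverse h)

theorem isOpen_isUnit_of_vecRegularOn (hX : IsOpen X) {F : ZariskiSpace σ → R}
    (hF : VecRegularOn X F) : IsOpen {x | x ∈ X ∧ IsUnit (F x)} := by
  let b := Module.finBasis ℂ R
  simp only [isUnit_iff_det_leftMulMatrix_ne_zero b]
  exact (VecRegularOn.det (hF.map (Algebra.leftMulMatrix b).toLinearMap).entry).isOpen_ne_zero hX

end

/-- `slicePoint` and `sliceCoord` are mutually inverse on the open sets where `1 + ι v` is a unit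
and the slice matrix is invertible. Allowing any subset `Y` of the class covers both whole classes
and `Δ`. -/
theorem localDim_eq_localDim_slice [FiniteDimensional ℂ R] {τ : Type} [Finite τ]
    (e : R ≃ₗ[ℂ] (τ → ℂ)) (hι : Function.Injective ι)
    (hc : IsCompl (LinearMap.range ι) (LinearMap.ker (intertwiner a a)))
    {Y : Set R} (hY : ∀ b ∈ Y, ∃ h : Rˣ, b = h * a * (h⁻¹ : Rˣ)) (ha : a ∈ Y)
    (h0 : (0 : Fin N → ℂ) ∈ {v : ZariskiSpace (Fin N) | IsUnit (1 + ι v) ∧ slicePoint ι a v ∈ Y}) :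
    localDim (X := ({y | e.symm y ∈ Y} : Set (ZariskiSpace τ)))
      ⟨e a, show e.symm (e a) ∈ Y by simpa using ha⟩ =
    localDim {v : ZariskiSpace (Fin N) | IsUnit (1 + ι v) ∧ slicePoint ι a v ∈ Y}
      ⟨(0 : Fin N → ℂ), h0⟩ := by
  -- The differential of the chart is injective because `range ι` misses the centralizer; a left
  -- inverse `P` makes the slice matrix at `a` the identity.
  obtain ⟨P, hP⟩ := LinearMap.exists_leftInverse_of_injective (intertwiner a a ∘ₗ ι) (by
    rw [LinearMap.ker_eq_bot']
    intro w hw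
    have := Submodule.disjoint_def.1 hc.disjoint (ι w) ⟨w, rfl⟩ hw
    exact hι (by rw [this, map_zero]))
  have hdet : (sliceMatrix ι P a a).det ≠ 0 := by
    rw [sliceMatrix, hP, LinearMap.toMatrix'_id, Matrix.det_one]
    exact one_ne_zero
  let X₀ : Set (ZariskiSpace (Fin N)) := {v | IsUnit (1 + ι v)}
  let U₀ : Set (ZariskiSpace τ) := {y | (sliceMatrix ι P a (e.symm y)).det ≠ 0}
  have hid : ∀ X : Set (ZariskiSpace (Fin N)), VecRegularOn X (M := Fin N → ℂ) fun v => v :=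
    fun X => .of_linear LinearMap.id
  have hes : ∀ X, VecRegularOn X fun y : ZariskiSpace τ => e.symm y :=
    fun X => .of_linear e.symm.toLinearMap
  have hX₀ : IsOpen X₀ := by
    simpa using isOpen_isUnit_of_vecRegularOn isOpen_univ
      ((VecRegularOn.const (1 : R)).add ((hid Set.univ).map ι))
  have hU₀ : IsOpen U₀ := by
    simpa using (VecRegularOn.det ((hes Set.univ).sliceMatrix (ι := ι) (P := P)
      (a := a)).entry).isOpen_ne_zero isOpen_univ
  have hθ : VecRegularOn X₀ fun v => slicePoint ι a v := (hid X₀).slicePoint fun v hv => hv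
  have hρ : VecRegularOn U₀ fun y => sliceCoord ι P a (e.symm y) := (hes U₀).sliceCoord fun y hy => hy
  have hV : IsOpen {v | v ∈ X₀ ∧ (sliceMatrix ι P a (slicePoint ι a v)).det ≠ 0} :=
    (VecRegularOn.det (hθ.sliceMatrix (ι := ι) (P := P) (a := a)).entry).isOpen_ne_zero hX₀
  have hU : IsOpen {y | y ∈ U₀ ∧ IsUnit (1 + ι (sliceCoord ι P a (e.symm y)))} :=
    isOpen_isUnit_of_vecRegularOn hU₀ ((VecRegularOn.const (1 : R)).add (hρ.map ι))
  symm
  refine localDim_eq_of_local_homeomorph hV hU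
    (f := fun v => e (slicePoint ι a v)) (g := fun y => sliceCoord ι P a (e.symm y))
    ?_ ?_ ?_ ?_ ?_ ?_ h0 ?_ _ ?_
  · exact RegularOn.continuousOn fun i => ((hθ.map e.toLinearMap) (LinearMap.proj i)).mono
      fun v hv => hv.1.1
  · exact RegularOn.continuousOn fun i => (hρ (LinearMap.proj i)).mono fun v hv => hv.2.1
  · rintro v ⟨⟨hv, hvY⟩, -, hvd⟩
    have h1 := eq_sliceCoord hvd ((eq_slicePoint_iff ι hv).1 rfl)
    refine ⟨?_, ?_, ?_⟩
    · change e.symm (e _) ∈ Y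
      rwa [e.symm_apply_apply]
    · change (sliceMatrix ι P a (e.symm (e _))).det ≠ 0
      rwa [e.symm_apply_apply]
    · change IsUnit (1 + ι (sliceCoord ι P a (e.symm (e _))))
      rwa [e.symm_apply_apply, ← h1]
  · rintro y ⟨hyY, hyd, hyu⟩
    have h1 := (eq_slicePoint_iff ι hyu).2 (intertwiner_sliceCoord hc hyd (hY _ hyY))
    refine ⟨⟨hyu, ?_⟩, hyu, ?_⟩
    · rwa [← h1]
    · rwa [← h1]
  · rintro v ⟨⟨hv, hvY⟩, -, hvd⟩
    change sliceCoord ι P a (e.symm (e _)) = v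
    rw [e.symm_apply_apply]
    exact (eq_sliceCoord hvd ((eq_slicePoint_iff ι hv).1 rfl)).symm
  · rintro y ⟨hyY, hyd, hyu⟩
    have h1 := (eq_slicePoint_iff ι hyu).2 (intertwiner_sliceCoord hc hyd (hY _ hyY))
    change e (slicePoint ι a (sliceCoord ι P a (e.symm y))) = y
    rw [← h1]
    exact e.apply_symm_apply y
  · refine ⟨h0.1, ?_⟩
    rwa [slicePoint_zero]
  · exact congrArg e (slicePoint_zero ι a)

variable (ι) in
theorem isOpen_isUnit_one_add [FiniteDimensional ℂ R] :
    IsOpen {v : ZariskiSpace (Fin N) | IsUnit (1 + ι v)} := by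
  have hid : VecRegularOn (Set.univ : Set (ZariskiSpace (Fin N))) (M := Fin N → ℂ) fun v => v :=
    .of_linear LinearMap.id
  simpa using isOpen_isUnit_of_vecRegularOn isOpen_univ ((VecRegularOn.const (1 : R)).add (hid.map ι))

theorem exists_conj_slicePoint {v : Fin N → ℂ} (hv : IsUnit (1 + ι v)) :
    ∃ h : Rˣ, slicePoint ι a v = h * a * (h⁻¹ : Rˣ) := by
  obtain ⟨h, hh⟩ := hv
  exact ⟨h, by rw [slicePoint, ← hh, Ring.inverse_unit]⟩

theorem finrank_range_intertwiner_conj (a : R) (h : Rˣ) :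
    Module.finrank ℂ (LinearMap.range (intertwiner (h * a * (h⁻¹ : Rˣ)) (h * a * (h⁻¹ : Rˣ)))) =
      Module.finrank ℂ (LinearMap.range (intertwiner a a)) := by
  let φ : R ≃ₗ[ℂ] R := LinearEquiv.ofBijective
    (LinearMap.mulLeft ℂ (h : R) ∘ₗ LinearMap.mulRight ℂ ((h⁻¹ : Rˣ) : R))
    (h.mulLeft_bijective.comp (h⁻¹).mulRight_bijective)
  have hφ : intertwiner (h * a * (h⁻¹ : Rˣ)) (h * a * (h⁻¹ : Rˣ)) ∘ₗ φ.toLinearMap =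
      φ.toLinearMap ∘ₗ intertwiner a a := by
    ext x
    change (h * (x * (h⁻¹ : Rˣ))) * (h * a * (h⁻¹ : Rˣ)) -
      (h * a * (h⁻¹ : Rˣ)) * (h * (x * (h⁻¹ : Rˣ))) = h * ((x * a - a * x) * (h⁻¹ : Rˣ))
    simp [mul_assoc, mul_sub, sub_mul]
  have := congrArg LinearMap.range hφ
  rw [LinearMap.range_comp, LinearEquiv.range, Submodule.map_top, LinearMap.range_comp] at this
  rw [this]
  exact φ.finrank_map_eq _

/-- The dimension of a conjugacy class in a finite dimensional algebra. -/
theorem zariskiDim_conjugates [FiniteDimensional ℂ R] {τ : Type} [Finite τ]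
    (e : R ≃ₗ[ℂ] (τ → ℂ)) (a : R) :
    zariskiDim {y : τ → ℂ | ∃ h : Rˣ, e.symm y = h * a * (h⁻¹ : Rˣ)} =
      (Module.finrank ℂ (LinearMap.range (intertwiner a a)) : ℕ) := by
  have hne : Nonempty {y : ZariskiSpace τ | ∃ h : Rˣ, e.symm y = h * a * (h⁻¹ : Rˣ)} :=
    ⟨⟨e a, 1, by simp⟩⟩
  refine (topologicalKrullDim_eq_of_localDim
    (X := {y : ZariskiSpace τ | ∃ h : Rˣ, e.symm y = h * a * (h⁻¹ : Rˣ)})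
    (d := (Module.finrank ℂ (LinearMap.range (intertwiner a a)) : ℕ)) ?_).trans rfl
  rintro ⟨y, hy⟩
  obtain ⟨b, rfl⟩ := e.surjective y
  have hb : ∃ h : Rˣ, b = h * a * (h⁻¹ : Rˣ) := by
    obtain ⟨h, hh⟩ := hy
    exact ⟨h, by rw [← hh]; exact (e.symm_apply_apply b).symm⟩
  obtain ⟨g, hg⟩ := hb
  obtain ⟨ι, hι, hc⟩ := exists_slice b
  have hY : ∀ b' ∈ {b' | ∃ h : Rˣ, b' = h * a * (h⁻¹ : Rˣ)}, ∃ h : Rˣ, b' = h * b * (h⁻¹ : Rˣ) := by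
    rintro _ ⟨h, rfl⟩
    exact ⟨h * g⁻¹, by simp [hg, mul_assoc]⟩
  have hY' : ∀ b', (∃ h : Rˣ, b' = h * b * (h⁻¹ : Rˣ)) → ∃ h : Rˣ, b' = h * a * (h⁻¹ : Rˣ) := by
    rintro _ ⟨h, rfl⟩
    exact ⟨h * g, by simp [hg, mul_assoc]⟩
  have h0 : IsUnit (1 + ι 0) := by simp
  refine (localDim_eq_localDim_slice (a := b) e hι hc hY ⟨g, hg⟩
    ⟨h0, hY' _ (exists_conj_slicePoint h0)⟩).trans ?_
  -- With no equations, the criterion gives the local dimension of the whole slice.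
  have key := ZariskiSpace.localDim_zeroLocus_of_linearIndependent
    (f := fun j : Fin 0 => j.elim0) (0 : Fin (Module.finrank ℂ (LinearMap.range
      (intertwiner b b))) → ℂ) (by rintro _ ⟨j, -⟩; exact j.elim0) linearIndependent_empty_type
  have hN : Module.finrank ℂ (LinearMap.range (intertwiner b b)) =
      Module.finrank ℂ (LinearMap.range (intertwiner a a)) := by
    rw [hg, finrank_range_intertwiner_conj]
  rw [← hN]
  refine (localDim_congr_of_inter_eq (isOpen_isUnit_one_add ι) _ h0 _ ?_).trans
    (key.2.trans (by simp))
  ext v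
  refine ⟨fun h => ⟨by rintro _ ⟨j, -⟩; exact j.elim0, h.2⟩,
    fun h => ⟨⟨h.2, hY' _ (exists_conj_slicePoint h.2)⟩, h.2⟩⟩

end Slice

/-! ### Schur's lemma and Burnside's theorem -/

section Irreducible

variable {n : ℕ}

/-- Schur's lemma: an eigenspace of `K` is invariant under the tuple, hence is everything. -/
theorem IsIrreducibleTuple.exists_eq_scalar_of_commute {A : Fin 4 → GL (Fin n) ℂ}
    (hA : IsIrreducibleTuple A) (K : Matrix (Fin n) (Fin n) ℂ)
    (hK : ∀ i, K * A i = A i * K) : ∃ c : ℂ, K = Matrix.scalar (Fin n) c := by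
  have : Nonempty (Fin n) := ⟨⟨0, hA.1⟩⟩
  obtain ⟨c, hc⟩ := Module.End.exists_eigenvalue (Matrix.toLin' K)
  refine ⟨c, ?_⟩
  have htop := (hA.2 (Module.End.eigenspace (Matrix.toLin' K) c) (by
    intro i w hw
    rw [Module.End.mem_eigenspace_iff, Matrix.toLin'_apply] at hw ⊢
    rw [Matrix.mulVec_mulVec, hK, ← Matrix.mulVec_mulVec, hw, Matrix.mulVec_smul])).resolve_left hc
  apply Matrix.toLin'.injective
  refine LinearMap.ext fun v => ?_
  have : v ∈ Module.End.eigenspace (Matrix.toLin' K) c := htop ▸ Submodule.mem_top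
  rw [Module.End.mem_eigenspace_iff.1 this, Matrix.toLin'_apply]
  simp

theorem isIrreducibleTuple_of_adjoin_eq_top (hn : 0 < n) {A : Fin 4 → GL (Fin n) ℂ}
    (h : Algebra.adjoin ℂ (Set.range fun i => (A i : Matrix (Fin n) (Fin n) ℂ)) = ⊤) :
    IsIrreducibleTuple A := by
  refine ⟨hn, fun W hW => ?_⟩
  have hall : ∀ M : Matrix (Fin n) (Fin n) ℂ, ∀ w ∈ W, M.mulVec w ∈ W := by
    intro M
    have hM : M ∈ Algebra.adjoin ℂ (Set.range fun i => (A i : Matrix (Fin n) (Fin n) ℂ)) :=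
      h ▸ Algebra.mem_top
    induction hM using Algebra.adjoin_induction with
    | mem x hx =>
      obtain ⟨i, rfl⟩ := hx
      exact hW i
    | algebraMap c =>
      intro w hw
      rw [Algebra.algebraMap_eq_smul_one, Matrix.smul_mulVec, Matrix.one_mulVec]
      exact W.smul_mem _ hw
    | add x y _ _ hx hy =>
      intro w hw
      rw [Matrix.add_mulVec]
      exact W.add_mem (hx w hw) (hy w hw)
    | mul x y _ _ hx hy =>
      intro w hw
      rw [← Matrix.mulVec_mulVec]
      exact hx _ (hy w hw)
  refine or_iff_not_imp_left.2 fun hbot => ?_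
  obtain ⟨w, hw, hw0⟩ := W.ne_bot_iff.1 hbot
  obtain ⟨i, hi⟩ := Function.ne_iff.1 hw0
  rw [eq_top_iff]
  intro v _
  -- This rank one matrix sends `w` to `v`.
  convert hall (Matrix.vecMulVec v (Pi.single i (w i)⁻¹)) w hw
  rw [Matrix.vecMulVec_mulVec]
  have hi' : w i ≠ 0 := hi
  ext j
  simp [hi']

/-- **Burnside's theorem** on matrix algebras. -/
theorem IsIrreducibleTuple.adjoin_eq_top {A : Fin 4 → GL (Fin n) ℂ} (hA : IsIrreducibleTuple A) :
    Algebra.adjoin ℂ (Set.range fun i => (A i : Matrix (Fin n) (Fin n) ℂ)) = ⊤ := by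
  have : Nonempty (Fin n) := ⟨⟨0, hA.1⟩⟩
  set 𝒜 := Algebra.adjoin ℂ (Set.range fun i => (A i : Matrix (Fin n) (Fin n) ℂ)) with h𝒜
  have hmem : ∀ i, (A i : Matrix (Fin n) (Fin n) ℂ) ∈ 𝒜 := fun i =>
    Algebra.subset_adjoin ⟨i, rfl⟩
  let : Module 𝒜 (Fin n → ℂ) := Module.compHom (Fin n → ℂ)
    ((Matrix.toLinAlgEquiv' (R := ℂ) (n := Fin n)).toRingEquiv.toRingHom.comp 𝒜.val.toRingHom)
  have smul_def : ∀ (a : 𝒜) (v : Fin n → ℂ), a • v = (a : Matrix (Fin n) (Fin n) ℂ).mulVec v :=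
    fun a v => rfl
  have scalar_smul : ∀ (c : ℂ) (v : Fin n → ℂ), (algebraMap ℂ 𝒜 c) • v = c • v := by
    intro c v
    rw [smul_def, Subalgebra.coe_algebraMap, Algebra.algebraMap_eq_smul_one, Matrix.smul_mulVec,
      Matrix.one_mulVec]
  have hsimple : IsSimpleModule 𝒜 (Fin n → ℂ) := by
    refine (isSimpleModule_iff ..).2 ⟨fun W => ?_⟩
    let W' : Submodule ℂ (Fin n → ℂ) :=
      { W.toAddSubmonoid with
        smul_mem' := fun c w hw => by
          rw [← scalar_smul]
          exact W.smul_mem _ hw }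
    have memW : ∀ v, v ∈ W' ↔ v ∈ W := fun _ => Iff.rfl
    refine (hA.2 W' fun i w hw => W.smul_mem ⟨_, hmem i⟩ hw).imp ?_ ?_
    · intro h
      ext v
      rw [← memW, h]
      rfl
    · intro h
      ext v
      rw [← memW, h]
      rfl
  have hend : ∀ f : Module.End 𝒜 (Fin n → ℂ), ∃ c : ℂ, ∀ v, f v = c • v := by
    intro f
    let f' : (Fin n → ℂ) →ₗ[ℂ] (Fin n → ℂ) :=
      { toFun := f
        map_add' := map_add f
        map_smul' := fun c v => by
          rw [← scalar_smul, map_smul, scalar_smul]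
          rfl }
    obtain ⟨c, hc⟩ := hA.exists_eq_scalar_of_commute (LinearMap.toMatrix' f') (by
      intro i
      apply Matrix.toLin'.injective
      rw [Matrix.toLin'_mul, Matrix.toLin'_mul, Matrix.toLin'_toMatrix']
      exact LinearMap.ext fun v => map_smul f ⟨_, hmem i⟩ v)
    refine ⟨c, fun v => ?_⟩
    have := congrArg (fun M => Matrix.toLin' M v) hc
    simp only [Matrix.toLin'_toMatrix'] at this
    refine Eq.trans this ?_
    simp
  rw [eq_top_iff]
  intro T _
  let fT : Module.End (Module.End 𝒜 (Fin n → ℂ)) (Fin n → ℂ) :=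
    { toFun := fun v => T.mulVec v
      map_add' := Matrix.mulVec_add T
      map_smul' := fun f v => by
        obtain ⟨c, hc⟩ := hend f
        simp only [Module.End.smul_def, hc, RingHom.id_apply, Matrix.mulVec_smul] }
  -- The endomorphisms of the simple module are scalars, so any `T` commutes with them; density on
  -- the standard basis then realises `T` inside the subalgebra.
  obtain ⟨r, hr⟩ := jacobson_density fT (Finset.univ.image fun i : Fin n => (Pi.single i 1 : Fin n → ℂ))
  have : T = r := by
    refine Matrix.ext_of_mulVec_single fun i => ?_
    exact hr (Pi.single i 1) (Finset.mem_image_of_mem _ (Finset.mem_univ i))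
  rw [this]
  exact r.2

end Irreducible

/-! ### Openness of irreducibility -/

section OpenIrreducible

variable {n : ℕ}

/-- The matrix whose rows are the entries of the values of noncommutative polynomials at `B`. -/
def wordMatrix (w : Fin n × Fin n → FreeAlgebra ℂ (Fin 4)) (B : Fin 4 → Matrix (Fin n) (Fin n) ℂ) :
    Matrix (Fin n × Fin n) (Fin n × Fin n) ℂ :=
  Matrix.of fun p q => FreeAlgebra.lift ℂ B (w p) q.1 q.2

theorem lift_mem_adjoin (B : Fin 4 → Matrix (Fin n) (Fin n) ℂ) (w : FreeAlgebra ℂ (Fin 4)) :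
    FreeAlgebra.lift ℂ B w ∈ Algebra.adjoin ℂ (Set.range B) := by
  induction w using FreeAlgebra.induction with
  | grade0 c => rw [AlgHom.commutes]; exact Subalgebra.algebraMap_mem _ _
  | grade1 i => rw [FreeAlgebra.lift_ι_apply]; exact Algebra.subset_adjoin ⟨i, rfl⟩
  | mul a b ha hb => rw [map_mul]; exact mul_mem ha hb
  | add a b ha hb => rw [map_add]; exact add_mem ha hb

/-- An invertible word matrix means that the `n²` words take values forming a basis of the matrix
algebra. Nonvanishing of its determinant is an open condition on `B` that ensures irreducibility
when `0 < n`. -/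
theorem adjoin_eq_top_of_det_wordMatrix_ne_zero {w : Fin n × Fin n → FreeAlgebra ℂ (Fin 4)}
    {B : Fin 4 → Matrix (Fin n) (Fin n) ℂ} (h : (wordMatrix w B).det ≠ 0) :
    Algebra.adjoin ℂ (Set.range B) = ⊤ := by
  rw [eq_top_iff]
  intro T _
  let c : Fin n × Fin n → ℂ := Matrix.vecMul (fun q => T q.1 q.2) (wordMatrix w B)⁻¹
  have hc : Matrix.vecMul c (wordMatrix w B) = fun q => T q.1 q.2 := by
    rw [Matrix.vecMul_vecMul, Matrix.nonsing_inv_mul _ (isUnit_iff_ne_zero.2 h), Matrix.vecMul_one]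
  have hT : T = ∑ p, c p • FreeAlgebra.lift ℂ B (w p) := by
    ext i j
    rw [← show _ = T i j from congrFun hc (i, j), Matrix.sum_apply]
    rfl
  rw [hT]
  exact sum_mem fun p _ => Subalgebra.smul_mem _ (lift_mem_adjoin B _) _

theorem exists_wordMatrix_eq_one {A : Fin 4 → Matrix (Fin n) (Fin n) ℂ}
    (hA : Algebra.adjoin ℂ (Set.range A) = ⊤) : ∃ w, wordMatrix w A = 1 := by
  have hsurj : Function.Surjective (FreeAlgebra.lift ℂ A) := by
    rw [← AlgHom.range_eq_top, eq_top_iff, ← hA]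
    refine Algebra.adjoin_le ?_
    rintro _ ⟨i, rfl⟩
    exact ⟨FreeAlgebra.ι ℂ i, FreeAlgebra.lift_ι_apply _ _⟩
  choose w hw using fun p : Fin n × Fin n => hsurj (Matrix.single p.1 p.2 1)
  refine ⟨w, ?_⟩
  ext p q
  simp only [wordMatrix, Matrix.of_apply, hw, Matrix.single_apply, Matrix.one_apply, Prod.ext_iff]

theorem VecRegularOn.freeAlgebra_lift {σ : Type} {X : Set (ZariskiSpace σ)}
    {F : ZariskiSpace σ → Fin 4 → Matrix (Fin n) (Fin n) ℂ} (hF : VecRegularOn X F)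
    (w : FreeAlgebra ℂ (Fin 4)) : VecRegularOn X fun x => FreeAlgebra.lift ℂ (F x) w := by
  induction w using FreeAlgebra.induction with
  | grade0 c => simpa only [AlgHom.commutes] using VecRegularOn.const _
  | grade1 i =>
    simp only [FreeAlgebra.lift_ι_apply]
    exact hF.map (LinearMap.proj i)
  | mul a b ha hb => simpa only [map_mul] using ha.mul hb
  | add a b ha hb => simpa only [map_add] using ha.add hb

theorem RegularOn.det_wordMatrix {σ : Type} {X : Set (ZariskiSpace σ)}
    {F : ZariskiSpace σ → Fin 4 → Matrix (Fin n) (Fin n) ℂ} (hF : VecRegularOn X F)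
    (w : Fin n × Fin n → FreeAlgebra ℂ (Fin 4)) :
    RegularOn X fun x => (wordMatrix w (F x)).det :=
  VecRegularOn.det fun p q => (hF.freeAlgebra_lift (w p)).entry q.1 q.2

end OpenIrreducible

/-! ### The differential of the product map -/

section Trace

variable {n : ℕ}

theorem exists_eq_trace_mul (ψ : Matrix (Fin n) (Fin n) ℂ →ₗ[ℂ] ℂ) :
    ∃ K : Matrix (Fin n) (Fin n) ℂ, ∀ X, ψ X = (K * X).trace := by
  refine ⟨Matrix.of fun i j => ψ (Matrix.single j i 1), fun X => ?_⟩
  conv_lhs => rw [Matrix.matrix_eq_sum_single X]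
  simp only [map_sum, Matrix.trace, Matrix.diag, Matrix.mul_apply, Matrix.of_apply]
  rw [Finset.sum_comm]
  refine Finset.sum_congr rfl fun i _ => Finset.sum_congr rfl fun j _ => ?_
  rw [mul_comm, ← smul_eq_mul, ← map_smul, Matrix.smul_single, smul_eq_mul, mul_one]

theorem eq_of_trace_mul_eq {K L : Matrix (Fin n) (Fin n) ℂ}
    (h : ∀ X, (K * X).trace = (L * X).trace) : K = L :=
  Matrix.ext_iff_trace_mul_right.2 h

/-- From `P A Q = r` follow `A Q P = r` and, by cyclicity of the trace, `tr (K P X A Q) = r tr (K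
X)`. The hypothesis therefore says `r K = Q P K A`, and left multiplication by `A` gives `r A K = r
K A`. -/
theorem commute_of_trace_eq_zero {r : ℂ} (hr : r ≠ 0) {A K P Q : Matrix (Fin n) (Fin n) ℂ}
    (hKP : K * P = P * K) (hPAQ : P * A * Q = Matrix.scalar (Fin n) r)
    (h : ∀ X, (K * (P * (X * A - A * X) * Q)).trace = 0) : K * A = A * K := by
  have hc : ∀ M : Matrix (Fin n) (Fin n) ℂ, Matrix.scalar (Fin n) r * M = r • M := by
    intro M
    rw [Matrix.scalar_apply, ← Matrix.smul_eq_diagonal_mul]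
  have hc1 : Matrix.scalar (Fin n) r = r • (1 : Matrix (Fin n) (Fin n) ℂ) := by
    rw [← hc, mul_one]
  have inv_comm : ∀ M N : Matrix (Fin n) (Fin n) ℂ, M * N = r • 1 → N * M = r • 1 := by
    intro M N hMN
    have : (r⁻¹ • M) * N = 1 := by rw [smul_mul_assoc, hMN, smul_smul, inv_mul_cancel₀ hr, one_smul]
    have := mul_eq_one_comm.1 this
    rw [mul_smul_comm] at this
    rw [← this, smul_smul, mul_inv_cancel₀ hr, one_smul]
  have hAQP : A * Q * P = r • 1 := inv_comm P (A * Q) (by rw [← mul_assoc, hPAQ, hc1])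
  have hQPA : Q * P * A = r • 1 := inv_comm A (Q * P) (by rw [← mul_assoc, hAQP])
  have key : r • K = Q * P * K * A := by
    refine eq_of_trace_mul_eq fun X => ?_
    have h1 := h X
    rw [mul_sub, sub_mul, mul_sub, Matrix.trace_sub, sub_eq_zero] at h1
    have e1 : (K * (P * (X * A) * Q)).trace = (r • K * X).trace := by
      rw [show K * (P * (X * A) * Q) = P * (K * X * (A * Q)) by
        simp only [← mul_assoc, hKP], Matrix.trace_mul_comm, mul_assoc, hAQP]
      simp
    have e2 : (K * (P * (A * X) * Q)).trace = (Q * P * K * A * X).trace := by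
      rw [show K * (P * (A * X) * Q) = (P * K * A * X) * Q by
        simp only [← mul_assoc, hKP], Matrix.trace_mul_comm]
      simp only [mul_assoc]
    rw [← e1, h1, e2]
  have h2 : r • (A * K) = r • (K * A) := by
    rw [← mul_smul_comm, key, show A * (Q * P * K * A) = A * Q * P * (K * A) by
      simp only [mul_assoc], hAQP, smul_mul_assoc, one_mul]
  exact (smul_right_injective _ hr h2).symm

/-- The derivative of a product of four matrices. -/
def productDerivative (b s : Fin 4 → Matrix (Fin n) (Fin n) ℂ) : Matrix (Fin n) (Fin n) ℂ :=
  ((s 0 * b 1 + b 0 * s 1) * b 2 + b 0 * b 1 * s 2) * b 3 + b 0 * b 1 * b 2 * s 3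

/-- Dual form of submersivity: modulo scalars, the product map on the four classes has surjective
differential at an irreducible tuple. Varying one factor at a time shows that the matrix `K`
representing `ψ` commutes with each `a i`, where each step uses the previous ones to move `K` past
the prefix `P`. -/
theorem eq_zero_of_productDerivative {r : ℂ} (hr : r ≠ 0) {A : Fin 4 → GL (Fin n) ℂ}
    (hA : IsIrreducibleTuple A)
    {a : Fin 4 → Matrix (Fin n) (Fin n) ℂ} (ha : ∀ i, a i = A i)
    (hprod : a 0 * a 1 * a 2 * a 3 = Matrix.scalar (Fin n) r)
    (ψ : Matrix (Fin n) (Fin n) ℂ →ₗ[ℂ] ℂ) (h1 : ψ 1 = 0)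
    (h : ∀ x, ψ (productDerivative a (intertwiner a a x)) = 0) : ψ = 0 := by
  obtain ⟨K, hK⟩ := exists_eq_trace_mul ψ
  have hs : ∀ (i : Fin 4) (X : Matrix (Fin n) (Fin n) ℂ),
      intertwiner a a (Pi.single i X) = Pi.single i (X * a i - a i * X) := by
    intro i X
    ext1 j
    rcases eq_or_ne j i with rfl | hij
    · simp
    · simp [hij]
  have h0 : K * a 0 = a 0 * K := by
    refine commute_of_trace_eq_zero hr (P := 1) (Q := a 1 * a 2 * a 3) (by simp)
      (by rw [← hprod]; simp only [mul_assoc, one_mul]) fun X => ?_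
    rw [← hK, ← h (Pi.single 0 X), hs]
    simp [productDerivative, mul_assoc]
  have h1' : K * a 1 = a 1 * K := by
    refine commute_of_trace_eq_zero hr (P := a 0) (Q := a 2 * a 3) h0
      (by rw [← hprod]; simp only [mul_assoc]) fun X => ?_
    rw [← hK, ← h (Pi.single 1 X), hs]
    simp [productDerivative, mul_assoc]
  have h2 : K * a 2 = a 2 * K := by
    refine commute_of_trace_eq_zero hr (P := a 0 * a 1) (Q := a 3)
      (by rw [← mul_assoc, h0, mul_assoc, h1', mul_assoc]) hprod fun X => ?_
    rw [← hK, ← h (Pi.single 2 X), hs]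
    simp [productDerivative, mul_assoc]
  have h3 : K * a 3 = a 3 * K := by
    refine commute_of_trace_eq_zero hr (P := a 0 * a 1 * a 2) (Q := 1)
      (by rw [← mul_assoc, ← mul_assoc, h0, mul_assoc (a 0), h1', ← mul_assoc, mul_assoc, h2,
        ← mul_assoc]) (by rw [mul_one, hprod]) fun X => ?_
    rw [← hK, ← h (Pi.single 3 X), hs]
    simp [productDerivative, mul_assoc]
  obtain ⟨c, rfl⟩ := hA.exists_eq_scalar_of_commute K (by
    intro i
    rw [← ha]
    fin_cases i
    exacts [h0, h1', h2, h3])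
  -- For scalar `K = c`, `ψ 1 = n c`, so `c = 0`.
  have hn : (n : ℂ) ≠ 0 := Nat.cast_ne_zero.2 hA.1.ne'
  rw [hK, mul_one] at h1
  have hc : c = 0 := by
    simpa [hn] using h1
  ext X
  simp [hK, hc]

end Trace

/-! ### Derivatives along lines -/

/-- Connects formal gradients with analytic derivatives, so that the gradient of a numerator can be
found by differentiating the matrix expression. -/
theorem hasDerivAt_eval_line {σ : Type} [Fintype σ] (p : MvPolynomial σ ℂ) (w : σ → ℂ) :
    HasDerivAt (fun t : ℂ => MvPolynomial.eval (t • w) p)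
      (∑ i, ZariskiSpace.gradient 0 p i * w i) 0 := by
  classical
  induction p using MvPolynomial.induction_on with
  | C a =>
    simp only [MvPolynomial.eval_C, ZariskiSpace.gradient_C, Pi.zero_apply, zero_mul,
      Finset.sum_const_zero]
    exact hasDerivAt_const _ _
  | add p q hp hq =>
    simp only [map_add, Pi.add_apply, add_mul, Finset.sum_add_distrib]
    exact hp.add hq
  | mul_X p i hp =>
    have hX : HasDerivAt (fun t : ℂ => MvPolynomial.eval (t • w) (MvPolynomial.X i : MvPolynomial σ ℂ))
        (w i) 0 := by
      simpa using (hasDerivAt_id (0 : ℂ)).mul_const (w i)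
    have := hp.mul hX
    simp only [map_mul]
    refine this.congr_deriv ?_
    rw [ZariskiSpace.gradient_mul, ZariskiSpace.gradient_X]
    simp [Pi.single_apply]

theorem hasDerivAt_conj {R : Type*} [NormedRing R] [NormedAlgebra ℂ R] [CompleteSpace R]
    (a s : R) :
    HasDerivAt (fun t : ℂ => (1 + t • s) * a * Ring.inverse (1 + t • s)) (s * a - a * s) 0 := by
  have h1 : HasDerivAt (fun t : ℂ => 1 + t • s) s 0 := by
    simpa using ((hasDerivAt_id (0 : ℂ)).smul_const s).const_add 1
  have h2 : HasDerivAt (fun t : ℂ => Ring.inverse (1 + t • s)) (-s) 0 := by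
    have h := hasFDerivAt_ringInverse (𝕜 := ℂ) (1 : Rˣ)
    have e : ((1 : Rˣ) : R) = 1 + (0 : ℂ) • s := by simp
    rw [e] at h
    have h3 := h.comp_hasDerivAt 0 h1
    have e3 : -(ContinuousLinearMap.mulLeftRight ℂ R ↑(1 : Rˣ)⁻¹ ↑(1 : Rˣ)⁻¹) s = -s := by simp
    exact e3 ▸ h3
  exact ((h1.mul_const a).mul h2).congr_deriv (by simp [sub_eq_add_neg])

section
open scoped Matrix.Norms.Operator

theorem hasDerivAt_product_conj {n : ℕ} (a s : Fin 4 → Matrix (Fin n) (Fin n) ℂ)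
    (ψ : Matrix (Fin n) (Fin n) ℂ →ₗ[ℂ] ℂ) :
    HasDerivAt (fun t : ℂ =>
      ψ (((1 + t • s) * a * Ring.inverse (1 + t • s)) 0 *
        ((1 + t • s) * a * Ring.inverse (1 + t • s)) 1 *
        ((1 + t • s) * a * Ring.inverse (1 + t • s)) 2 *
        ((1 + t • s) * a * Ring.inverse (1 + t • s)) 3))
      (ψ (productDerivative a (intertwiner a a s))) 0 := by
  have h := hasDerivAt_pi.1 (hasDerivAt_conj a s)
  have h4 := (((h 0).mul (h 1)).mul (h 2)).mul (h 3)
  refine ((ψ.toContinuousLinearMap.hasFDerivAt).comp_hasDerivAt 0 h4).congr_deriv ?_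
  simp [productDerivative]
  exact map_add ψ _ _

end

/-- The functionals force `M = c`, and the determinant gives `c ^ n = r ^ n`. The factor `∑ c ^ k r
^ (n - 1 - k)` of `c ^ n - r ^ n` being nonzero excludes the other `n`-th roots. -/
theorem eq_scalar_of_functionals {n : ℕ} (i₀ : Fin n) {r : ℂ} (M : Matrix (Fin n) (Fin n) ℂ)
    (hM : ∀ ψ : Matrix (Fin n) (Fin n) ℂ →ₗ[ℂ] ℂ, ψ 1 = 0 → ψ M = 0) (hdet : M.det = r ^ n)
    (hq : ∑ k ∈ Finset.range n, M i₀ i₀ ^ k * r ^ (n - 1 - k) ≠ 0) :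
    M = Matrix.scalar (Fin n) r := by
  have hspan : M ∈ Submodule.span ℂ {(1 : Matrix (Fin n) (Fin n) ℂ)} := by
    rw [← Subspace.dualAnnihilator_dualCoannihilator_eq (W := Submodule.span ℂ
      {(1 : Matrix (Fin n) (Fin n) ℂ)}), Submodule.mem_dualCoannihilator]
    intro ψ hψ
    exact hM ψ ((Submodule.mem_dualAnnihilator ψ).1 hψ 1 (Submodule.mem_span_singleton_self 1))
  obtain ⟨c, rfl⟩ := Submodule.mem_span_singleton.1 hspan
  have hc : (c • (1 : Matrix (Fin n) (Fin n) ℂ)) i₀ i₀ = c := by simp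
  rw [hc] at hq
  rw [Matrix.det_smul, Matrix.det_one, mul_one, Fintype.card_fin] at hdet
  have hgeom := Commute.geom_sum₂_mul (Commute.all c r) n
  rw [hdet, sub_self, mul_eq_zero] at hgeom
  rw [sub_eq_zero.1 (hgeom.resolve_left hq), Matrix.scalar_apply, Matrix.smul_one_eq_diagonal]

/-! ### Conjugacy classes and the tuples of `Δ` as matrices -/

section ConjugacyClasses

variable {n : ℕ}

/-- The coordinates of a matrix. -/
def matrixCoordinates (n : ℕ) : Matrix (Fin n) (Fin n) ℂ ≃ₗ[ℂ] (Fin n × Fin n → ℂ) where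
  toFun M p := M p.1 p.2
  invFun y := Matrix.of fun i j => y (i, j)
  map_add' _ _ := rfl
  map_smul' _ _ := rfl
  left_inv _ := rfl
  right_inv _ := rfl

/-- The coordinates of a 4-tuple of matrices. -/
def tupleCoordinates (n : ℕ) :
    (Fin 4 → Matrix (Fin n) (Fin n) ℂ) ≃ₗ[ℂ] (Fin 4 × Fin n × Fin n → ℂ) where
  toFun M p := M p.1 p.2.1 p.2.2
  invFun y i := Matrix.of fun j k => y (i, j, k)
  map_add' _ _ := rfl
  map_smul' _ _ := rfl
  left_inv _ := rfl
  right_inv _ := rfl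

theorem mem_carrier_iff_exists_conj {C : ConjClasses (GL (Fin n) ℂ)} {A : GL (Fin n) ℂ}
    (hA : A ∈ C.carrier) (B : GL (Fin n) ℂ) :
    B ∈ C.carrier ↔ ∃ h : GL (Fin n) ℂ, B = h * A * h⁻¹ := by
  rw [ConjClasses.mem_carrier_iff_mk_eq] at hA ⊢
  rw [← hA, eq_comm, ConjClasses.mk_eq_mk_iff_isConj, isConj_iff]
  simp only [eq_comm]

theorem classDim_eq_finrank {C : ConjClasses (GL (Fin n) ℂ)} {A : GL (Fin n) ℂ}
    (hA : A ∈ C.carrier) : classDim C = (Module.finrank ℂ (LinearMap.range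
      (intertwiner (A : Matrix (Fin n) (Fin n) ℂ) (A : Matrix (Fin n) (Fin n) ℂ))) : ℕ) := by
  rw [classDim, ← zariskiDim_conjugates (matrixCoordinates n)]
  congr 1
  ext y
  constructor
  · rintro ⟨B, hB, rfl⟩
    obtain ⟨h, rfl⟩ := (mem_carrier_iff_exists_conj hA B).1 hB
    exact ⟨h, rfl⟩
  · rintro ⟨h, hh⟩
    refine ⟨h * A * h⁻¹, (mem_carrier_iff_exists_conj hA _).2 ⟨h, rfl⟩, ?_⟩
    rw [← (matrixCoordinates n).apply_symm_apply y, hh]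
    rfl

theorem finrank_range_intertwiner_pi (a : Fin 4 → Matrix (Fin n) (Fin n) ℂ) :
    Module.finrank ℂ (LinearMap.range (intertwiner a a)) =
      ∑ i, Module.finrank ℂ (LinearMap.range (intertwiner (a i) (a i))) := by
  rw [← Module.finrank_pi_fintype]
  refine LinearEquiv.finrank_eq
    { toFun := fun y i => ⟨y.1 i, by
        obtain ⟨x, hx⟩ := y.2
        exact ⟨x i, congrFun hx i⟩⟩
      invFun := fun z => ⟨fun i => (z i).1, by
        choose x hx using fun i => (z i).2
        exact ⟨x, funext hx⟩⟩
      map_add' := fun _ _ => rfl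
      map_smul' := fun _ _ => rfl
      left_inv := fun _ => rfl
      right_inv := fun _ => rfl }

/-- The matrices underlying the tuples in `Δ`. -/
def deltaMatrices (C : Fin 4 → ConjClasses (GL (Fin n) ℂ)) (r : ℂ) :
    Set (Fin 4 → Matrix (Fin n) (Fin n) ℂ) :=
  (fun A i => (A i : Matrix (Fin n) (Fin n) ℂ)) '' DeltaSet C r

theorem deltaMatrices_conj {C : Fin 4 → ConjClasses (GL (Fin n) ℂ)} {r : ℂ}
    {A : Fin 4 → GL (Fin n) ℂ} (hA : A ∈ DeltaSet C r) :
    ∀ b ∈ deltaMatrices C r, ∃ h : (Fin 4 → Matrix (Fin n) (Fin n) ℂ)ˣ,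
      b = h * (fun i => (A i : Matrix (Fin n) (Fin n) ℂ)) *
        (h⁻¹ : (Fin 4 → Matrix (Fin n) (Fin n) ℂ)ˣ) := by
  rintro _ ⟨B, hB, rfl⟩
  choose h hh using fun i => (mem_carrier_iff_exists_conj (hA.1 i) (B i)).1 (hB.1 i)
  refine ⟨MulEquiv.piUnits.symm h, ?_⟩
  ext1 i
  change (B i : Matrix (Fin n) (Fin n) ℂ) = _
  rw [hh]
  rfl

/-- Conjugacy keeps the classes and generation keeps irreducibility, so only the product equation is
left to impose. -/
theorem mem_deltaMatrices {C : Fin 4 → ConjClasses (GL (Fin n) ℂ)} {r : ℂ}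
    {A : Fin 4 → GL (Fin n) ℂ} (hA : A ∈ DeltaSet C r) {b : Fin 4 → Matrix (Fin n) (Fin n) ℂ}
    (hb : ∃ h : (Fin 4 → Matrix (Fin n) (Fin n) ℂ)ˣ,
      b = h * (fun i => (A i : Matrix (Fin n) (Fin n) ℂ)) *
        (h⁻¹ : (Fin 4 → Matrix (Fin n) (Fin n) ℂ)ˣ))
    (hirr : Algebra.adjoin ℂ (Set.range b) = ⊤) :
    b ∈ deltaMatrices C r ↔ b 0 * b 1 * b 2 * b 3 = Matrix.scalar (Fin n) r := by
  constructor
  · rintro ⟨B, hB, rfl⟩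
    exact hB.2.2
  · intro hprod
    obtain ⟨h, rfl⟩ := hb
    refine ⟨fun i => MulEquiv.piUnits h i * A i * (MulEquiv.piUnits h i)⁻¹, ⟨fun i => ?_, ?_, ?_⟩, rfl⟩
    · exact (mem_carrier_iff_exists_conj (hA.1 i) _).2 ⟨_, rfl⟩
    · exact isIrreducibleTuple_of_adjoin_eq_top hA.2.1.1 hirr
    · exact hprod

theorem det_prod_conj {A : Fin 4 → Matrix (Fin n) (Fin n) ℂ} {r : ℂ}
    (hA : A 0 * A 1 * A 2 * A 3 = Matrix.scalar (Fin n) r)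
    {b : Fin 4 → Matrix (Fin n) (Fin n) ℂ} (hb : ∃ h : (Fin 4 → Matrix (Fin n) (Fin n) ℂ)ˣ,
      b = h * A * (h⁻¹ : (Fin 4 → Matrix (Fin n) (Fin n) ℂ)ˣ)) :
    (b 0 * b 1 * b 2 * b 3).det = r ^ n := by
  obtain ⟨h, rfl⟩ := hb
  have key : ∀ i, Matrix.det (((h : Fin 4 → Matrix (Fin n) (Fin n) ℂ) * A *
      ((h⁻¹ : (Fin 4 → Matrix (Fin n) (Fin n) ℂ)ˣ) : Fin 4 → Matrix (Fin n) (Fin n) ℂ)) i) =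
      (A i).det := by
    intro i
    exact Matrix.det_units_conj (MulEquiv.piUnits h i) (A i)
  rw [Matrix.det_mul, Matrix.det_mul, Matrix.det_mul, key, key, key, key, ← Matrix.det_mul,
    ← Matrix.det_mul, ← Matrix.det_mul, hA]
  simp

end ConjugacyClasses

/-! ### Equations of `Δ` in a slice -/

theorem finrank_dualAnnihilator_one {n : ℕ} (hn : 0 < n) :
    Module.finrank ℂ (Submodule.span ℂ {(1 : Matrix (Fin n) (Fin n) ℂ)}).dualAnnihilator =
      n ^ 2 - 1 := by
  have : Nonempty (Fin n) := ⟨⟨0, hn⟩⟩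
  have h := Subspace.finrank_add_finrank_dualAnnihilator_eq
    (Submodule.span ℂ {(1 : Matrix (Fin n) (Fin n) ℂ)})
  rw [finrank_span_singleton one_ne_zero, Module.finrank_matrix] at h
  simp only [Fintype.card_fin, Module.finrank_self, mul_one] at h
  rw [pow_two]
  omega

/-- The product of a 4-tuple of matrices. -/
def tupleProd {n : ℕ} (b : Fin 4 → Matrix (Fin n) (Fin n) ℂ) : Matrix (Fin n) (Fin n) ℂ :=
  b 0 * b 1 * b 2 * b 3

theorem VecRegularOn.tupleProd {n : ℕ} {σ : Type} {X : Set (ZariskiSpace σ)}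
    {F : ZariskiSpace σ → Fin 4 → Matrix (Fin n) (Fin n) ℂ} (hF : VecRegularOn X F) :
    VecRegularOn X fun x => tupleProd (F x) :=
  have h : ∀ i, VecRegularOn X fun x => F x i := fun i =>
    hF.map (LinearMap.proj (φ := fun _ : Fin 4 => Matrix (Fin n) (Fin n) ℂ) i)
  (((h 0).mul (h 1)).mul (h 2)).mul (h 3)

theorem eventually_isUnit_one_add_smul {R : Type*} [NormedRing R] [NormedAlgebra ℂ R]
    [CompleteSpace R] (s : R) : ∀ᶠ t : ℂ in 𝓝 0, IsUnit (1 + t • s) := by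
  have hc : ContinuousAt (fun t : ℂ => 1 + t • s) 0 := by fun_prop
  exact hc.eventually_mem (Units.isOpen.mem_nhds (by simp))

section Equations

variable {n N : ℕ} {ι : (Fin N → ℂ) →ₗ[ℂ] Fin 4 → Matrix (Fin n) (Fin n) ℂ}
  {a : Fin 4 → Matrix (Fin n) (Fin n) ℂ}

theorem vecRegularOn_slicePoint :
    VecRegularOn {v : ZariskiSpace (Fin N) | IsUnit (1 + ι v)} fun v => slicePoint ι a v :=
  VecRegularOn.slicePoint (F := fun v => v) (.of_linear LinearMap.id) fun _ hv => hv

open scoped Matrix.Norms.Operator in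
-- Differentiating `p = h · ψ(product)` along `t v`: the term containing the derivative of `h`
-- disappears because `ψ` vanishes on the product at the base point.
theorem gradient_of_eq_div (ψ : Matrix (Fin n) (Fin n) ℂ →ₗ[ℂ] ℂ) (hψ : ψ (tupleProd a) = 0)
    {p h : MvPolynomial (Fin N) ℂ} (hph : ∀ v : Fin N → ℂ, IsUnit (1 + ι v) →
      MvPolynomial.eval v h ≠ 0 ∧ ψ (tupleProd (slicePoint ι a v)) =
        MvPolynomial.eval v p / MvPolynomial.eval v h) (v : Fin N → ℂ) :
    ∑ i, ZariskiSpace.gradient 0 p i * v i =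
      MvPolynomial.eval 0 h * ψ (productDerivative a (intertwiner a a (ι v))) := by
  have h1 := hasDerivAt_eval_line p v
  have h2 := (hasDerivAt_eval_line h v).mul (hasDerivAt_product_conj a (ι v) ψ)
  have hev : ∀ᶠ t : ℂ in 𝓝 0, IsUnit (1 + ι (t • v)) := by
    simp only [map_smul]
    exact eventually_isUnit_one_add_smul _
  refine h1.unique ((h2.congr_deriv ?_).congr_of_eventuallyEq ?_)
  · have : ψ (tupleProd (slicePoint ι a ((0 : ℂ) • v))) = 0 := by
      rw [zero_smul, slicePoint_zero, hψ]
    rw [slicePoint, map_smul] at this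
    change _ * ψ (tupleProd _) + _ = _
    rw [this, mul_zero, zero_add, zero_smul]
  · filter_upwards [hev] with t ht
    obtain ⟨h3, h4⟩ := hph _ ht
    have h5 := (eq_div_iff h3).1 h4
    rw [slicePoint, map_smul] at h5
    rw [← h5, mul_comm]
    rfl

/-- The equations are the numerators of `ψ(product)` for `ψ` in a basis of the functionals killing
the identity. A linear relation among their gradients, with coefficients rescaled by the nonzero
denominators at `0`, is a functional as in `eq_zero_of_productDerivative`. -/
theorem exists_equations (hn : 0 < n) {r : ℂ} (hr : r ≠ 0) {A : Fin 4 → GL (Fin n) ℂ}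
    (hA : IsIrreducibleTuple A) (ha : ∀ i, a i = A i)
    (hprod : tupleProd a = Matrix.scalar (Fin n) r)
    (hsurj : ∀ x, ∃ w, intertwiner a a (ι w) = intertwiner a a x) :
    ∃ p : Fin (n ^ 2 - 1) → MvPolynomial (Fin N) ℂ,
      LinearIndependent ℂ (fun j => ZariskiSpace.gradient (0 : Fin N → ℂ) (p j)) ∧
      ∀ v : Fin N → ℂ, IsUnit (1 + ι v) → ((∀ g ∈ Set.range p, MvPolynomial.eval v g = 0) ↔
        ∀ ψ : Matrix (Fin n) (Fin n) ℂ →ₗ[ℂ] ℂ, ψ 1 = 0 → ψ (tupleProd (slicePoint ι a v)) = 0) := by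
  let W := (Submodule.span ℂ {(1 : Matrix (Fin n) (Fin n) ℂ)}).dualAnnihilator
  let b : Module.Basis (Fin (n ^ 2 - 1)) ℂ W :=
    Module.finBasisOfFinrankEq ℂ W (finrank_dualAnnihilator_one hn)
  have hW1 : ∀ ψ ∈ W, ψ 1 = 0 := fun ψ hψ =>
    (Submodule.mem_dualAnnihilator ψ).1 hψ 1 (Submodule.mem_span_singleton_self 1)
  have hWr : ∀ ψ ∈ W, ψ (tupleProd a) = 0 := fun ψ hψ => by
    rw [hprod, Matrix.scalar_apply, ← Matrix.smul_one_eq_diagonal, map_smul, hW1 ψ hψ, smul_zero]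
  choose p h hph using fun j => (vecRegularOn_slicePoint (ι := ι) (a := a)).tupleProd (b j).1
  have h0 : IsUnit (1 + ι 0) := by simp
  refine ⟨p, ?_, fun v hv => ?_⟩
  · have hgrad : ∀ j v, ∑ i, ZariskiSpace.gradient 0 (p j) i * v i =
        MvPolynomial.eval (0 : Fin N → ℂ) (h j) *
          (b j).1 (productDerivative a (intertwiner a a (ι v))) := fun j v =>
      gradient_of_eq_div _ (hWr _ (b j).2) (hph j) v
    rw [Fintype.linearIndependent_iff]
    intro c hcs
    have hψ : (∑ j, (c j * MvPolynomial.eval (0 : Fin N → ℂ) (h j)) • (b j)).1 = 0 := by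
      refine eq_zero_of_productDerivative hr hA ha hprod _
        (hW1 _ (Subtype.property _)) fun x => ?_
      obtain ⟨v, hv⟩ := hsurj x
      rw [← hv]
      have h1 := congrArg (fun g : Fin N → ℂ => ∑ i, g i * v i) hcs
      simp only [Finset.sum_apply, Pi.smul_apply, smul_eq_mul, Pi.zero_apply, zero_mul,
        Finset.sum_const_zero, Finset.sum_mul] at h1
      rw [Finset.sum_comm] at h1
      simp only [mul_assoc, ← Finset.mul_sum, hgrad] at h1
      simpa [mul_assoc] using h1
    have h2 := Fintype.linearIndependent_iff.1 b.linearIndependent _ (Subtype.ext hψ)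
    exact fun j => (mul_eq_zero.1 (h2 j)).resolve_right (hph j (0 : Fin N → ℂ) h0).1
  · rw [Set.forall_mem_range]
    have hj : ∀ j, MvPolynomial.eval v (p j) = 0 ↔ (b j).1 (tupleProd (slicePoint ι a v)) = 0 := by
      intro j
      obtain ⟨h1, h2⟩ := hph j v hv
      rw [show (b j).1 (tupleProd (slicePoint ι a v)) = _ from h2, div_eq_zero_iff]
      exact (or_iff_left h1).symm
    simp only [hj]
    refine ⟨fun hall ψ hψ => ?_, fun hall j => hall _ (hW1 _ (b j).2)⟩
    have hψW : ψ ∈ W := (Submodule.mem_dualAnnihilator ψ).2 fun x hx => by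
      obtain ⟨c, rfl⟩ := Submodule.mem_span_singleton.1 hx
      rw [map_smul, hψ, smul_zero]
    have := congrArg Subtype.val (b.sum_repr ⟨ψ, hψW⟩)
    refine (congrArg (fun φ => φ (tupleProd (slicePoint ι a v))) this).symm.trans ?_
    simp only [Submodule.coe_sum, Submodule.coe_smul, LinearMap.sum_apply, LinearMap.smul_apply, hall,
      smul_zero, Finset.sum_const_zero]

end Equations

/-! ### The dimension of `Δ` -/

/-- On the open set of the slice where the word matrix is invertible and the root-separating sum is
nonzero, `Δ` coincides with the zero locus of the `n² - 1` independent equations. -/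
theorem localDim_deltaMatrices {n : ℕ} {r : ℂ} (hr : r ≠ 0)
    {C : Fin 4 → ConjClasses (GL (Fin n) ℂ)} {A : Fin 4 → GL (Fin n) ℂ} (hA : A ∈ DeltaSet C r)
    {a : Fin 4 → Matrix (Fin n) (Fin n) ℂ} (ha : a = fun i => (A i : Matrix (Fin n) (Fin n) ℂ))
    (haΔ : a ∈ deltaMatrices C r) {N : ℕ}
    {ι : (Fin N → ℂ) →ₗ[ℂ] Fin 4 → Matrix (Fin n) (Fin n) ℂ} (hι : Function.Injective ι)
    (hc : IsCompl (LinearMap.range ι) (LinearMap.ker (intertwiner a a))) :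
    n ^ 2 - 1 ≤ N ∧
    localDim (X := ({y | (tupleCoordinates n).symm y ∈ deltaMatrices C r} :
        Set (ZariskiSpace (Fin 4 × Fin n × Fin n))))
      ⟨tupleCoordinates n a, haΔ⟩ = ((N - (n ^ 2 - 1) : ℕ) : ℕ∞) := by
  have hn := hA.2.1.1
  let i₀ : Fin n := ⟨0, hn⟩
  have hprod : tupleProd a = Matrix.scalar (Fin n) r := by
    rw [ha]
    exact hA.2.2
  have hsurj : ∀ x, ∃ w, intertwiner a a (ι w) = intertwiner a a x := by
    intro x
    obtain ⟨_, ⟨w, rfl⟩, k, hk, rfl⟩ := Submodule.mem_sup.1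
      (hc.sup_eq_top ▸ Submodule.mem_top : x ∈ LinearMap.range ι ⊔ _)
    exact ⟨w, by rw [map_add, LinearMap.mem_ker.1 hk, add_zero]⟩
  have hX₀ := isOpen_isUnit_one_add ι
  have h0 : IsUnit (1 + ι 0) := by simp
  have hθ := vecRegularOn_slicePoint (ι := ι) (a := a)
  obtain ⟨w, hw⟩ := exists_wordMatrix_eq_one (A := a) (by rw [ha]; exact hA.2.1.adjoin_eq_top)
  have hU₁ := (RegularOn.det_wordMatrix hθ w).isOpen_ne_zero hX₀
  have hq := (RegularOn.sum (Finset.range n) fun k _ => ((RegularOn.prod (Finset.range k) fun _ _ =>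
    hθ.tupleProd.entry i₀ i₀).mul (.const (r ^ (n - 1 - k))))).isOpen_ne_zero hX₀
  simp only [Finset.prod_const, Finset.card_range] at hq
  have hU := hU₁.inter hq
  obtain ⟨p, hlin, hp⟩ := exists_equations hn hr hA.2.1 (fun i => congrFun ha i) hprod hsurj
  have hscalar : ∀ ψ : Matrix (Fin n) (Fin n) ℂ →ₗ[ℂ] ℂ, ψ 1 = 0 →
      ψ (Matrix.scalar (Fin n) r) = 0 := fun ψ hψ => by
    rw [Matrix.scalar_apply, ← Matrix.smul_one_eq_diagonal, map_smul, hψ, smul_zero]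
  have hzero : ∀ g ∈ Set.range p, MvPolynomial.eval (0 : Fin N → ℂ) g = 0 :=
    (hp 0 h0).2 fun ψ hψ => by rw [slicePoint_zero, hprod, hscalar ψ hψ]
  have key := ZariskiSpace.localDim_zeroLocus_of_linearIndependent p (0 : Fin N → ℂ) hzero hlin
  rw [Fintype.card_fin] at key
  refine ⟨key.1, ?_⟩
  have hY : ∀ b ∈ deltaMatrices C r, ∃ h : (Fin 4 → Matrix (Fin n) (Fin n) ℂ)ˣ,
      b = h * a * (h⁻¹ : (Fin 4 → Matrix (Fin n) (Fin n) ℂ)ˣ) := by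
    rw [ha]
    exact deltaMatrices_conj hA
  have h0' : slicePoint ι a 0 ∈ deltaMatrices C r := by rwa [slicePoint_zero]
  refine (localDim_eq_localDim_slice (tupleCoordinates n) hι hc hY haΔ ⟨h0, h0'⟩).trans ?_
  refine (localDim_congr_of_inter_eq
    (B := {x : ZariskiSpace (Fin N) | ∀ g ∈ Set.range p, MvPolynomial.eval x g = 0}) hU _ ⟨⟨h0, ?_⟩, h0, ?_⟩ hzero ?_).trans key.2
  · rw [slicePoint_zero, hw, Matrix.det_one]
    exact one_ne_zero
  -- At the base point all `n` terms equal `r ^ (n - 1)`, so the sum is `n r ^ (n - 1)`, which is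
  -- nonzero.
  · rw [slicePoint_zero, hprod]
    have : (Matrix.scalar (Fin n) r) i₀ i₀ = r := by simp
    rw [this, Finset.sum_congr rfl fun k hk => by
      rw [← pow_add, show k + (n - 1 - k) = n - 1 by have := Finset.mem_range.1 hk; omega]]
    rw [Finset.sum_const, Finset.card_range, nsmul_eq_mul]
    exact mul_ne_zero (Nat.cast_ne_zero.2 hn.ne') (pow_ne_zero _ hr)
  · ext v
    refine and_congr_left ?_
    rintro ⟨⟨hv, hvw⟩, -, hvq⟩
    have hconj := exists_conj_slicePoint (a := a) hv
    have hmem := mem_deltaMatrices hA (ha ▸ hconj) (adjoin_eq_top_of_det_wordMatrix_ne_zero hvw)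
    have hiff : tupleProd (slicePoint ι a v) = Matrix.scalar (Fin n) r ↔
        ∀ g ∈ Set.range p, MvPolynomial.eval v g = 0 := by
      rw [hp v hv]
      refine ⟨fun h ψ hψ => by rw [h, hscalar ψ hψ], fun h => ?_⟩
      exact eq_scalar_of_functionals i₀ _ h (det_prod_conj hprod hconj) hvq
    exact ⟨fun h => hiff.1 (hmem.1 h.2), fun h => ⟨hv, hmem.2 (hiff.2 h)⟩⟩

end

theorem mainTheorem3 (n : ℕ) (q r : ℂ) (hq : q ≠ 0) (hr : r ^ 2 = q)
    (C : Fin 4 → ConjClasses (GL (Fin n) ℂ))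
    (hdet : ∏ i, classDet (C i) = r ^ n) :
    ∃ d : Fin 4 → ℕ, (∀ i, classDim (C i) = (d i : WithBot ℕ∞)) ∧
      (0 ≤ (∑ i, (d i : ℤ)) - (n : ℤ) ^ 2 + 1 → (DeltaSet C r).Nonempty →
        ∃ D : ℕ, tupleDim (DeltaSet C r) = (D : WithBot ℕ∞) ∧
          (D : ℤ) = (∑ i, (d i : ℤ)) - (n : ℤ) ^ 2 + 1) ∧
      ((∑ i, (d i : ℤ)) - (n : ℤ) ^ 2 + 1 < 0 → DeltaSet C r = ∅) := by
  have hr0 : r ≠ 0 := by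
    rintro rfl
    exact hq (by rw [← hr]; simp)
  choose g hg using fun i => ConjClasses.exists_rep (C i)
  have hgC : ∀ i, g i ∈ (C i).carrier := fun i => ConjClasses.mem_carrier_iff_mk_eq.2 (hg i)
  let d : Fin 4 → ℕ := fun i => Module.finrank ℂ (LinearMap.range
    (intertwiner (g i : Matrix (Fin n) (Fin n) ℂ) (g i : Matrix (Fin n) (Fin n) ℂ)))
  have hd : ∀ i, classDim (C i) = (d i : WithBot ℕ∞) := fun i => classDim_eq_finrank (hgC i)
  have hloc : ∀ A ∈ DeltaSet C r, ∀ haΔ, n ^ 2 - 1 ≤ ∑ i, d i ∧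
      localDim (X := ({y | (tupleCoordinates n).symm y ∈ deltaMatrices C r} :
        Set (ZariskiSpace (Fin 4 × Fin n × Fin n))))
      ⟨tupleCoordinates n fun i => (A i : Matrix (Fin n) (Fin n) ℂ), haΔ⟩ =
      ((∑ i, d i - (n ^ 2 - 1) : ℕ) : ℕ∞) := by
    intro A hA haΔ
    obtain ⟨ι, hι, hc⟩ := exists_slice fun i => (A i : Matrix (Fin n) (Fin n) ℂ)
    have hN : Module.finrank ℂ (LinearMap.range (intertwiner
        (fun i => (A i : Matrix (Fin n) (Fin n) ℂ)) (fun i => (A i : Matrix (Fin n) (Fin n) ℂ)))) =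
        ∑ i, d i := by
      rw [finrank_range_intertwiner_pi]
      refine Finset.sum_congr rfl fun i _ => ?_
      have h1 := (classDim_eq_finrank (hA.1 i)).symm.trans (hd i)
      exact_mod_cast h1
    rw [← hN]
    exact localDim_deltaMatrices hr0 hA rfl haΔ hι hc
  -- Irreducibility includes `0 < n`, so the natural number subtraction `n ^ 2 - 1` is not
  -- truncated.
  have hpos : ∀ A ∈ DeltaSet C r, 1 ≤ n ^ 2 := fun A hA => Nat.one_le_pow _ _ hA.2.1.1
  refine ⟨d, hd, fun _ hne => ?_, fun hneg => ?_⟩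
  · obtain ⟨A, hA⟩ := hne
    refine ⟨∑ i, d i - (n ^ 2 - 1), ?_, ?_⟩
    · have hset : tuplePoint '' DeltaSet C r =
          {y | (tupleCoordinates n).symm y ∈ deltaMatrices C r} := by
        ext y
        constructor
        · rintro ⟨B, hB, rfl⟩
          exact ⟨B, hB, rfl⟩
        · rintro ⟨B, hB, hBy⟩
          refine ⟨B, hB, ?_⟩
          rw [← (tupleCoordinates n).apply_symm_apply y, ← hBy]
          rfl
      rw [tupleDim, hset]
      have hne' : Nonempty ({y | (tupleCoordinates n).symm y ∈ deltaMatrices C r} :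
        Set (ZariskiSpace (Fin 4 × Fin n × Fin n))) := ⟨⟨tuplePoint A, A, hA, rfl⟩⟩
      refine (topologicalKrullDim_eq_of_localDim (X := ({y | (tupleCoordinates n).symm y ∈
        deltaMatrices C r} : Set (ZariskiSpace (Fin 4 × Fin n × Fin n))))
        (d := (∑ i, d i - (n ^ 2 - 1) : ℕ)) ?_).trans rfl
      rintro ⟨y, B, hB, hBy⟩
      have hy : y = tupleCoordinates n fun i => (B i : Matrix (Fin n) (Fin n) ℂ) :=
        (congrArg (tupleCoordinates n) hBy).symm
      subst hy
      exact (hloc B hB _).2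
    · have h1 := (hloc A hA ⟨A, hA, rfl⟩).1
      have h2 := hpos A hA
      push_cast [Nat.cast_sub h1, Nat.cast_sub h2]
      ring
  -- A single point of `Δ` yields `n² - 1 ≤ ∑ d i`, that is `D ≥ 0`.
  · by_contra hne
    obtain ⟨A, hA⟩ := Set.nonempty_iff_ne_empty.2 hne
    have h1 := (hloc A hA ⟨A, hA, rfl⟩).1
    have h2 := hpos A hA
    zify [h2] at h1
    linarith
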